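/- **Setting.** Write $[k]=\{1,\dots,k\}$. A dataset is $z=(z_1,\dots,z_n)\in[D]^n$; its histogram is $h_j=|\{i: z_i=j\}|$, $j\in[D]$, and its anonymized histogram $\mathbf n=(n^{(1)},\dots,n^{(D)})$ lists the $h_j$ in nonincreasing order. In general an anonymized histogram of length $k$ is a nonincreasing vector $\mathbf m\in\mathbb Z_{\ge 0}^k$; put $\|\mathbf m\|_1=\sum_j m^{(j)}$ and $\phi^{\mathbf m}_{\ge r}=|\{j: m^{(j)}\ge r\}|$ for $r\in[n]$, and let $\phi^{\mathbf m}_{\ge}=(\phi^{\mathbf m}_{\ge 1},\dots,\phi^{\mathbf m}_{\ge n})$. For $p\in(0,1)$, $\mathrm{DLap}(p)$ is the distribution on $\mathbb Z$ with mass $\frac{1-p}{1+p}p^{|i|}$ at $i$. For a function $H:[D]\to[B]$ and $\mathbf v\in\mathbb Z_{\ge0}^D$, the reduced histogram has entries $\sum_{j\in H^{-1}(b)}v_j$, $b\in[B]$. For an anonymized histogram $\mathbf m$ of length $D$, $\Gamma^B(\mathbf m)\in\mathbb R^n$ is the expectation, over a uniformly random $H:[D]\to[B]$, of $\phi_{\ge}$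 of the sorted reduced histogram of $\mathbf m$. Let $f:\mathbb Z\to\mathbb R$ be $f(m)=1$ for $m>0$, $f(0)=1+\frac{p}{(1-p)^2}$, $f(-1)=-\frac{p}{(1-p)^2}$, $f(m)=0$ for $m<-1$. **Algorithm** (parameters $n,D,B,p$). Draw a uniformly random $H:[D]\to[B]$, let $h^{\mathrm{red}}$ be the reduced histogram of $h$, and let $\tilde h_b=h^{\mathrm{red}}_b+\xi_b$ with $\xi_b\sim\mathrm{DLap}(p)$ i.i.d. and independent of $H$. From $\tilde h$ (and the parameters) only: 1. compute $\hat\phi_{\ge r}=\sum_{b\in[B]}f(\tilde h_b-r)$ for $r\in[n]$ and let $\hat{\mathbf n}^{\mathrm{red}}$ be an anonymized histogram of length $B$ minimizing $\|\phi^{\hat{\mathbf n}^{\mathrm{red}}}_{\ge}-\hat\phi_{\ge}\|_1$; 2. output an anonymized histogram $\hat{\mathbf n}$ of length $D$ with $\|\hat{\mathbf n}\|_1=n$ minimizing $\|\Gamma^B(\hat{\mathbf n})-\phi^{\hat{\mathbf n}^{\mathrm{red}}}_{\ge}\|_1$ among all such. Ties are broken by an arbitrary deterministic rule. **Claim.**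 For every $\varepsilon_0>0$ there is a constant $C>0$, depending only on $\varepsilon_0$, such that for all $0<\varepsilon\le\varepsilon_0$, all integers $n\ge 2$ and $D$, all integers $B$ with $|B-n\sqrt{\log n}|<1$ (i.e. $B=n\sqrt{\log n}$ rounded up or down), and every tie-breaking rule, the algorithm with $p=e^{-\varepsilon/2}$ satisfies: * it is $\varepsilon$-differentially private: for any $z,z'\in[D]^n$ that differ in at most one entry and every set $E$ of outputs, $\Pr[\hat{\mathbf n}(z)\in E]\le e^{\varepsilon}\Pr[\hat{\mathbf n}(z')\in E]$; * for every dataset $z\in[D]^n$ its expected $\ell_1$-error satisfies $$\mathbb E\Big[\sum_{j\in[D]}|\hat n^{(j)}-n^{(j)}|\Big]\le C\,\frac{\sqrt n\,(\log n)^{3/4}}{\varepsilon^{2.5}}.$$ -/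

import Mathlib

open MeasureTheory

noncomputable section

namespace AnonHist

/-! ### Differential privacy -/

/-- Two datasets are neighboring if they agree except possibly in the entry of one user. -/
def Neighboring {n : ℕ} {Z : Type*} (z z' : Fin n → Z) : Prop :=
  ∃ i, ∀ j, j ≠ i → z j = z' j

/-- `M` maps each dataset to the law of its random output.  It is `(ε, δ)`-differentially private if
these laws are probability measures and `Pr[M z ∈ E] ≤ e^ε * Pr[M z' ∈ E] + δ` for all neighboring
`z, z'` and all measurable events `E`. -/
def IsApproxDP {n : ℕ} {Z R : Type*} [MeasurableSpace R]
    (ε δ : ℝ) (M : (Fin n → Z) → Measure R) : Prop :=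
  (∀ z, IsProbabilityMeasure (M z)) ∧
    ∀ z z', Neighboring z z' → ∀ E : Set R, MeasurableSet E →
      M z E ≤ ENNReal.ofReal (Real.exp ε) * M z' E + ENNReal.ofReal δ

/-- Pure differential privacy, `ε`-DP. -/
def IsDP {n : ℕ} {Z R : Type*} [MeasurableSpace R]
    (ε : ℝ) (M : (Fin n → Z) → Measure R) : Prop :=
  IsApproxDP ε 0 M

/-- The discrete Laplace distribution: mass `(1 - p) / (1 + p) * p ^ |i|` at `i : ℤ`. -/
def dLap (p : ℝ) : Measure ℤ :=
  Measure.count.withDensity fun i => ENNReal.ofReal ((1 - p) / (1 + p) * p ^ i.natAbs)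

/-! ### Histograms -/

/-- The histogram of a dataset of `n` users with items in a domain of size `D`. -/
def hist {n D : ℕ} (z : Fin n → Fin D) (j : Fin D) : ℕ :=
  (Finset.univ.filter fun i => z i = j).card

/-- The anonymized histogram: the entries sorted in nonincreasing order (`Tuple.sort h` sorts them
in nondecreasing order, `Fin.rev` reverses the indices).  An arbitrary anonymized histogram is an
antitone function `Fin D → ℕ`. -/
def anonymize {D : ℕ} (h : Fin D → ℕ) (l : Fin D) : ℕ :=
  h (Tuple.sort h l.rev)

/-- The cumulative prevalence `φ_{≥ r}`: the number of entries with value at least `r`. -/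
def cumPrev {D : ℕ} (h : Fin D → ℕ) (r : ℕ) : ℕ :=
  (Finset.univ.filter fun j => r ≤ h j).card

/-- The `ℓ₁`-distance of two (anonymized) histograms. -/
def l1Dist {D : ℕ} (m m' : Fin D → ℕ) : ℝ :=
  ∑ j, |(m j : ℝ) - (m' j : ℝ)|

/-- The `ℓ₁`-distance on the coordinates `1, …, n`, on which cumulative prevalences live. -/
def l1Upto (n : ℕ) (u v : ℕ → ℝ) : ℝ :=
  ∑ r ∈ Finset.Icc 1 n, |u r - v r|

/-! ### The estimator for a noised histogram -/

/-- The post-processing function `f : ℤ → ℝ`. -/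
def postF (p : ℝ) (m : ℤ) : ℝ :=
  if 0 < m then 1
  else if m = 0 then 1 + p / (1 - p) ^ 2
  else if m = -1 then -(p / (1 - p) ^ 2)
  else 0

/-- The estimate of `φ_{≥ r}` from a noised histogram `w`. -/
def phiHat {B : ℕ} (p : ℝ) (w : Fin B → ℤ) (r : ℕ) : ℝ :=
  ∑ b, postF p (w b - (r : ℤ))

/-- `m` is a possible output of the basic estimator on the noised histogram `w`: an anonymized
histogram whose cumulative prevalence is `ℓ₁`-closest to the estimate `phiHat p w`. -/
def IsBasicEstimate {B : ℕ} (p : ℝ) (n : ℕ) (w : Fin B → ℤ) (m : Fin B → ℕ) : Prop :=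
  Antitone m ∧ ∀ m' : Fin B → ℕ, Antitone m' →
    l1Upto n (fun r => (cumPrev m r : ℝ)) (phiHat p w) ≤
      l1Upto n (fun r => (cumPrev m' r : ℝ)) (phiHat p w)

/-! ### Hashing -/

/-- The law of a uniformly random hash function `Fin D → Fin B`. -/
def hashLaw (D B : ℕ) : Measure (Fin D → Fin B) :=
  ProbabilityTheory.uniformOn Set.univ

/-- The reduced histogram: bucket `b` receives the total count of the items hashed to it. -/
def reduce {D B : ℕ} (H : Fin D → Fin B) (h : Fin D → ℕ) (b : Fin B) : ℕ :=
  ∑ j ∈ Finset.univ.filter (fun j => H j = b), h j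

/-- The map `Γ^B`: the expected cumulative prevalence, over a random hash function into `B` buckets,
of the anonymized reduced histogram. -/
def gammaMap {D : ℕ} (B : ℕ) (m : Fin D → ℕ) (r : ℕ) : ℝ :=
  ∫ H, (cumPrev (anonymize (reduce H m)) r : ℝ) ∂(hashLaw D B)

/-- `m` is a possible output of the large-domain estimator on the noised reduced histogram `w`: for
some output `mRed` of the basic estimator on `w`, it is an anonymized histogram with total count `n`
for which `Γ^B m` is `ℓ₁`-closest to the cumulative prevalence of `mRed`. -/
def IsHashedEstimate {D B : ℕ} (p : ℝ) (n : ℕ) (w : Fin B → ℤ) (m : Fin D → ℕ) : Prop :=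
  ∃ mRed : Fin B → ℕ, IsBasicEstimate p n w mRed ∧
    (Antitone m ∧ ∑ j, m j = n) ∧
    ∀ m' : Fin D → ℕ, Antitone m' → ∑ j, m' j = n →
      l1Upto n (gammaMap B m) (fun r => (cumPrev mRed r : ℝ)) ≤
        l1Upto n (gammaMap B m') (fun r => (cumPrev mRed r : ℝ))

/-- `est` implements the large-domain estimator (with an arbitrary rule for breaking ties). -/
def IsHashedEstimator {D B : ℕ} (p : ℝ) (n : ℕ) (est : (Fin B → ℤ) → (Fin D → ℕ)) : Prop :=
  ∀ w, IsHashedEstimate p n w (est w)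

/-- The law of the output of the whole algorithm on the dataset `z`: draw a uniform hash function and
independent discrete Laplace noise for each bucket, form the noised reduced histogram, apply `est`. -/
def mechanism {n D B : ℕ} (p : ℝ) (est : (Fin B → ℤ) → (Fin D → ℕ)) (z : Fin n → Fin D) :
    Measure (Fin D → ℕ) :=
  ((hashLaw D B).prod (Measure.pi fun _ : Fin B => dLap p)).map
    fun ω => est fun b => (reduce ω.1 (hist z) b : ℤ) + ω.2 b

/-- Minimizers exist: over a nonempty domain the estimator can be implemented. -/
theorem exists_isHashedEstimator {D B : ℕ} (p : ℝ) (n : ℕ) (hD : 0 < D) :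
    ∃ est : (Fin B → ℤ) → (Fin D → ℕ), IsHashedEstimator p n est := by
  have key : ∀ w : Fin B → ℤ, ∃ m : Fin D → ℕ, IsHashedEstimate p n w m := by
    intro w
    have hbasic : ∃ mRed : Fin B → ℕ, IsBasicEstimate p n w mRed := by
      let S : Set ℝ :=
        (fun m : Fin B → ℕ => l1Upto n (fun r => (cumPrev m r : ℝ)) (phiHat p w)) ''
          {m | Antitone m}
      have hfin : S.Finite := by
        refine (Set.finite_range (fun v : Fin (n + 1) → Fin (B + 1) =>
          l1Upto n (fun r => ((v (Fin.ofNat (n + 1) r) : ℕ) : ℝ)) (phiHat p w))).subset ?_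
        rintro _ ⟨m, -, rfl⟩
        refine ⟨fun r => ⟨cumPrev m r, Nat.lt_succ_of_le ?_⟩, ?_⟩
        · exact (Finset.card_le_univ _).trans (by simp)
        · refine Finset.sum_congr rfl fun r hr => ?_
          have : r % (n + 1) = r := Nat.mod_eq_of_lt (by simp at hr; omega)
          simp [Fin.ofNat, this]
      have hne : S.Nonempty := ⟨_, fun _ => 0, antitone_const, rfl⟩
      obtain ⟨x, ⟨m, hm, rfl⟩, hx⟩ := Set.exists_min_image S id hfin hne
      exact ⟨m, hm, fun m' hm' => hx _ ⟨m', hm', rfl⟩⟩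
    obtain ⟨mRed, hRed⟩ := hbasic
    let T : Set (Fin D → ℕ) := {m | Antitone m ∧ ∑ j, m j = n}
    have hfin : T.Finite := by
      refine (Set.finite_Iic (fun _ : Fin D => n)).subset ?_
      rintro m ⟨-, hm⟩ j
      rw [← hm]
      exact Finset.single_le_sum (f := m) (fun _ _ => Nat.zero_le _) (Finset.mem_univ j)
    have hne : T.Nonempty := by
      refine ⟨fun j => if j = ⟨0, hD⟩ then n else 0, ?_, by simp⟩
      intro a b hab
      by_cases hb : b = ⟨0, hD⟩
      · have ha : a = ⟨0, hD⟩ := by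
          subst hb
          exact le_antisymm hab (Nat.zero_le _)
        simp [ha, hb]
      · simp [hb]
    obtain ⟨m, hm, hmin⟩ := Set.exists_min_image T
      (fun m => l1Upto n (gammaMap B m) (fun r => (cumPrev mRed r : ℝ))) hfin hne
    exact ⟨m, mRed, hRed, hm, fun m' h1 h2 => hmin m' ⟨h1, h2⟩⟩
  choose est hest using key
  exact ⟨est, hest⟩

end AnonHist

end

/-!
# Privacy and accuracy of the hashed estimator for anonymized histograms

*Privacy.* For a fixed hash function, changing one user moves one unit of count between two buckets,
so the reduced histogram moves by at most `2` in `ℓ₁`. Discrete Laplace noise with parameter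
`exp (-ε / 2)` hides such a shift up to the factor `exp ε` (`pi_dLap_shift_le`), and everything else
is post-processing.

*Accuracy.* Each error is a vector indexed by the thresholds `r`, and its `ℓ₁`-norm is bounded by
Cauchy-Schwarz with weights `r`, at the price of the harmonic sum `∑ 1 / r ≤ 1 + log n`
(`l1Upto_sq_le`). There are three ingredients.

* Noise: `postF` inverts the noise, so `phiHat` is an unbiased estimate of the cumulative
  prevalence, with variance of order `p ^ |h b - r| / (1 - p) ^ 3` per bucket (`postF_moments`).
  The weighted sum over `r` is of order `(n + B) / (1 - p) ^ 5` (`sum_mul_integral_phiHat_le`).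
* Hashing: a cumulative prevalence of the reduced histogram depends on the bucket of a single item
  only through collisions of this item. Efron-Stein and the mean load `n / B` of a bucket give a
  weighted variance of order `n ^ 2 / B` (`sum_mul_variance_cumPrev_reduce_le`).
* Inversion: passing from sorted histograms to cumulative prevalences is an `ℓ₁`-isometry, and the
  collisions perturb it by a map with Lipschitz constant at most `4 n / B`. Hence `Γ` is stably
  invertible as soon as `8 n ≤ B` (`l1Dist_le_l1Upto_gammaMap`), and since the true histogram
  competes in both minimizations, the error of the output is at most a constant times the two errors above
  (`l1Dist_estimate_le`).

With `B` about `n √(log n)` the noise dominates and yields the rate `√n (log n)^(3/4) / ε^(5/2)`. If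
`B < 8 n`, then `n` is bounded by an absolute constant and the trivial bound `2 n` is enough.
-/

namespace AnonHist

/-! ### Threshold indicators and cumulative prevalences -/

/-- The indicator of `r ≤ x`, as a real number. -/
def thr (r x : ℕ) : ℝ := if r ≤ x then 1 else 0

theorem thr_mono (r : ℕ) : Monotone (thr r) := by
  intro x y h
  unfold thr
  split_ifs <;> first | omega | norm_num

theorem sum_thr (n x : ℕ) : ∑ r ∈ Finset.Icc 1 n, thr r x = (min n x : ℕ) := by
  unfold thr
  rw [Finset.sum_ite, Finset.sum_const_zero, add_zero, Finset.sum_const, nsmul_eq_mul, mul_one]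
  congr 1
  have : Finset.filter (fun r => r ≤ x) (Finset.Icc 1 n) = Finset.Icc 1 (min n x) := by
    ext r
    simp only [Finset.mem_filter, Finset.mem_Icc, le_min_iff, and_assoc]
  rw [this]; simp

theorem sum_mul_thr {n x : ℕ} (hx : x ≤ n) :
    ∑ r ∈ Finset.Icc 1 n, (r : ℝ) * thr r x = x * (x + 1) / 2 := by
  have h1 : ∑ r ∈ Finset.Icc 1 n, (r : ℝ) * thr r x = ∑ r ∈ Finset.range (x + 1), (r : ℝ) := by
    unfold thr
    simp only [mul_ite, mul_one, mul_zero]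
    rw [← Finset.sum_filter]
    refine Finset.sum_subset_zero_on_sdiff ?_ ?_ fun _ _ => rfl
    · intro r hr
      simp only [Finset.mem_filter, Finset.mem_Icc, Finset.mem_range] at hr ⊢
      omega
    · intro r hr
      have : r = 0 := by simp at hr; omega
      simp [this]
  rw [h1]
  clear h1 hx
  induction x with
  | zero => simp
  | succ k ih => rw [Finset.sum_range_succ, ih]; push_cast; ring

theorem abs_thr_sub (r x y : ℕ) : |thr r x - thr r y| = thr r (max x y) - thr r (min x y) := by
  rcases le_total x y with h | h
  · rw [max_eq_right h, min_eq_left h, abs_sub_comm, abs_of_nonneg (sub_nonneg.2 (thr_mono r h))]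
  · rw [max_eq_left h, min_eq_right h, abs_of_nonneg (sub_nonneg.2 (thr_mono r h))]

theorem sum_abs_thr_sub_le (n x y : ℕ) :
    ∑ r ∈ Finset.Icc 1 n, |thr r x - thr r y| ≤ |(x : ℝ) - y| := by
  simp only [abs_thr_sub, Finset.sum_sub_distrib, sum_thr]
  rcases le_total x y with h | h
  · rw [max_eq_right h, min_eq_left h, abs_sub_comm]
    refine le_trans ?_ (le_abs_self _)
    rw [sub_le_iff_le_add, sub_add_eq_add_sub, le_sub_iff_add_le]
    exact_mod_cast (by omega : min n y + x ≤ y + min n x)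
  · rw [max_eq_left h, min_eq_right h]
    refine le_trans ?_ (le_abs_self _)
    rw [sub_le_iff_le_add, sub_add_eq_add_sub, le_sub_iff_add_le]
    exact_mod_cast (by omega : min n x + y ≤ x + min n y)

theorem sum_abs_thr_sub {n x y : ℕ} (hx : x ≤ n) (hy : y ≤ n) :
    ∑ r ∈ Finset.Icc 1 n, |thr r x - thr r y| = |(x : ℝ) - y| := by
  simp only [abs_thr_sub, Finset.sum_sub_distrib, sum_thr]
  rcases le_total x y with h | h
  · rw [max_eq_right h, min_eq_left h, abs_sub_comm, min_eq_right hx, min_eq_right hy,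
      abs_of_nonneg (by simpa using h)]
  · rw [max_eq_left h, min_eq_right h, min_eq_right hx, min_eq_right hy,
      abs_of_nonneg (by simpa using h)]

/-- The weighted squared effect of a collision: a bucket with load `x` receives an item of count
`y`, and each threshold `r` is charged with the failure of additivity of `thr r` there. -/
theorem sum_mul_collision_sq_le {n x y : ℕ} (h : x + y ≤ n) :
    ∑ r ∈ Finset.Icc 1 n, (r : ℝ) * (thr r (x + y) - thr r x - thr r y) ^ 2 ≤ 3 * (x * y) := by
  have h1 : ∀ r, (thr r (x + y) - thr r x - thr r y) ^ 2
      = thr r (x + y) - thr r x - thr r y + 2 * thr r (min x y) := by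
    intro r
    unfold thr
    split_ifs <;> first | omega | norm_num
  have h2 : ∑ r ∈ Finset.Icc 1 n, (r : ℝ) * (thr r (x + y) - thr r x - thr r y) ^ 2
      = x * y + (min x y : ℕ) * ((min x y : ℕ) + 1) := by
    simp only [h1, mul_add, mul_sub, Finset.sum_add_distrib, Finset.sum_sub_distrib,
      mul_left_comm _ (2 : ℝ), ← Finset.mul_sum]
    rw [sum_mul_thr h, sum_mul_thr (by omega : x ≤ n), sum_mul_thr (by omega : y ≤ n),
      sum_mul_thr (by omega : min x y ≤ n)]
    push_cast
    ring
  rw [h2]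
  have h3 : min x y * (min x y + 1) ≤ 2 * (x * y) := by
    rcases le_total x y with h | h
    · rw [min_eq_left h]
      rcases Nat.eq_zero_or_pos x with rfl | hx
      · simp
      · nlinarith
    · rw [min_eq_right h]
      rcases Nat.eq_zero_or_pos y with rfl | hx
      · simp
      · nlinarith
  have h4 : ((min x y : ℕ) : ℝ) * ((min x y : ℕ) + 1) ≤ 2 * (x * y) := by exact_mod_cast h3
  linarith

theorem cumPrev_eq_sum {D : ℕ} (h : Fin D → ℕ) (r : ℕ) :
    (cumPrev h r : ℝ) = ∑ j, thr r (h j) := by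
  simp [cumPrev, thr]

theorem sum_anonymize {D : ℕ} {M : Type*} [AddCommMonoid M] (h : Fin D → ℕ) (g : ℕ → M) :
    ∑ l, g (anonymize h l) = ∑ j, g (h j) :=
  Equiv.sum_comp (Fin.revPerm.trans (Tuple.sort h)) fun j => g (h j)

theorem cumPrev_anonymize {D : ℕ} (h : Fin D → ℕ) (r : ℕ) :
    cumPrev (anonymize h) r = cumPrev h r := by
  have : (cumPrev (anonymize h) r : ℝ) = cumPrev h r := by
    rw [cumPrev_eq_sum, cumPrev_eq_sum, sum_anonymize h (thr r)]
  exact_mod_cast this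

theorem antitone_anonymize {D : ℕ} (h : Fin D → ℕ) : Antitone (anonymize h) := by
  intro a b hab
  exact Tuple.monotone_sort h (Fin.rev_le_rev.2 hab)

theorem sum_hist {n D : ℕ} (z : Fin n → Fin D) : ∑ j, hist z j = n := by
  unfold hist
  rw [Finset.sum_card_fiberwise_eq_card_filter]
  simp

/-- For sorted vectors the transport distance of the entries is the `ℓ₁`-distance of the
vectors. -/
theorem l1Dist_eq_l1Upto {n D : ℕ} {m m' : Fin D → ℕ} (hm : Antitone m) (hm' : Antitone m')
    (hn : ∀ j, m j ≤ n) (hn' : ∀ j, m' j ≤ n) :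
    l1Dist m m' = l1Upto n (fun r => (cumPrev m r : ℝ)) (fun r => (cumPrev m' r : ℝ)) := by
  unfold l1Dist l1Upto
  simp only [← fun j => sum_abs_thr_sub (hn j) (hn' j)]
  rw [Finset.sum_comm]
  refine Finset.sum_congr rfl fun r _ => ?_
  rw [cumPrev_eq_sum, cumPrev_eq_sum, ← Finset.sum_sub_distrib]
  -- The superlevel sets of antitone vectors are nested, so all differences have the same sign.
  by_cases hex : ∃ j, m' j < r ∧ r ≤ m j
  · obtain ⟨j, h1, h2⟩ := hex
    have hs : ∀ i, 0 ≤ thr r (m i) - thr r (m' i) := by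
      intro i
      unfold thr
      rcases le_total i j with h | h
      · rw [if_pos (h2.trans (hm h))]
        split_ifs <;> norm_num
      · rw [if_neg (not_le.2 ((hm' h).trans_lt h1))]
        split_ifs <;> norm_num
    rw [abs_of_nonneg (Finset.sum_nonneg fun i _ => hs i)]
    exact Finset.sum_congr rfl fun i _ => abs_of_nonneg (hs i)
  · push Not at hex
    have hs : ∀ i, thr r (m i) - thr r (m' i) ≤ 0 := by
      intro i
      rcases lt_or_ge (m' i) r with h | h
      · have := hex i h
        unfold thr
        split_ifs <;> first | omega | norm_num
      · unfold thr
        split_ifs <;> norm_num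
    rw [abs_of_nonpos (Finset.sum_nonpos fun i _ => hs i), ← Finset.sum_neg_distrib]
    exact Finset.sum_congr rfl fun i _ => abs_of_nonpos (hs i)

theorem l1Upto_triangle (n : ℕ) (u v w : ℕ → ℝ) : l1Upto n u w ≤ l1Upto n u v + l1Upto n v w := by
  unfold l1Upto
  rw [← Finset.sum_add_distrib]
  exact Finset.sum_le_sum fun r _ => abs_sub_le _ _ _

theorem l1Upto_comm (n : ℕ) (u v : ℕ → ℝ) : l1Upto n u v = l1Upto n v u :=
  Finset.sum_congr rfl fun _ _ => abs_sub_comm _ _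

theorem l1Upto_nonneg (n : ℕ) (u v : ℕ → ℝ) : 0 ≤ l1Upto n u v :=
  Finset.sum_nonneg fun _ _ => abs_nonneg _

/-- Cauchy-Schwarz with weights `r`: the price of passing to second moments is a harmonic sum. -/
theorem l1Upto_sq_le (n : ℕ) (u v : ℕ → ℝ) :
    l1Upto n u v ^ 2 ≤ (1 + Real.log n) * ∑ r ∈ Finset.Icc 1 n, (r : ℝ) * (u r - v r) ^ 2 := by
  have h1 := Finset.sum_sq_le_sum_mul_sum_of_sq_le_mul (Finset.Icc 1 n)
    (r := fun r => |u r - v r|) (f := fun r => ((r : ℝ))⁻¹)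
    (g := fun r => (r : ℝ) * (u r - v r) ^ 2) (fun _ _ => by positivity)
    (fun _ _ => by positivity) (fun r hr => by
      have : (r : ℝ) ≠ 0 := by
        have := (Finset.mem_Icc.1 hr).1
        positivity
      rw [sq_abs, inv_mul_cancel_left₀ this])
  refine h1.trans (mul_le_mul_of_nonneg_right ?_ (Finset.sum_nonneg fun _ _ => by positivity))
  have := harmonic_le_one_add_log n
  rw [harmonic_eq_sum_Icc] at this
  push_cast at this
  exact this

/-! ### Loads of hashed items -/

/-- Inserting an item with count `a` changes the number of buckets with load at least `r` only
through the bucket of that item. -/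
theorem cumPrev_reduce_update {D B : ℕ} (H : Fin D → Fin B) {w : Fin D → ℕ} {j : Fin D}
    (hw : w j = 0) (a r : ℕ) :
    (cumPrev (reduce H (Function.update w j a)) r : ℝ) =
      cumPrev (reduce H w) r + thr r (reduce H w (H j) + a) - thr r (reduce H w (H j)) := by
  have h1 : ∀ b, reduce H (Function.update w j a) b
      = reduce H w b + if b = H j then a else 0 := by
    intro b
    unfold reduce
    have : ∀ i, Function.update w j a i = w i + if i = j then a else 0 := by
      intro i
      by_cases h : i = j
      · subst h; simp [hw]
      · simp [h]
    simp only [this, Finset.sum_add_distrib]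
    congr 1
    rw [Finset.sum_ite_eq']
    simp [eq_comm]
  rw [cumPrev_eq_sum, cumPrev_eq_sum]
  have h2 : ∀ b, thr r (reduce H (Function.update w j a) b) = thr r (reduce H w b) +
      if b = H j then thr r (reduce H w (H j) + a) - thr r (reduce H w (H j)) else 0 := by
    intro b
    rw [h1]
    split_ifs with h
    · subst h; ring
    · simp
  simp only [h2, Finset.sum_add_distrib, Finset.sum_ite_eq', Finset.mem_univ, if_true]
  ring

theorem sum_reduce {D B : ℕ} (H : Fin D → Fin B) (h : Fin D → ℕ) :
    ∑ b, reduce H h b = ∑ j, h j :=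
  Finset.sum_fiberwise Finset.univ H h

theorem reduce_eq_sum_ite {D B : ℕ} (H : Fin D → Fin B) (h : Fin D → ℕ) (b : Fin B) :
    reduce H h b = ∑ j, if H j = b then h j else 0 := by
  rw [reduce, Finset.sum_filter]

/-! ### Averages over finite products -/

open scoped BigOperators

theorem expect_sub_sq {α : Type*} [Fintype α] [Nonempty α] (f : α → ℝ) (c : ℝ) :
    𝔼 x, (f x - c) ^ 2 = 𝔼 x, (f x - 𝔼 y, f y) ^ 2 + (𝔼 y, f y - c) ^ 2 := by
  have h : ∀ a : ℝ, 𝔼 x, (f x - a) ^ 2 = 𝔼 x, f x ^ 2 - 2 * a * 𝔼 x, f x + a ^ 2 := by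
    intro a
    simp only [sub_sq, Finset.expect_add_distrib, Finset.expect_sub_distrib, Fintype.expect_const,
      mul_right_comm _ _ a, ← Finset.mul_expect]
  rw [h, h]
  ring

theorem expect_sq_nonneg {α : Type*} [Fintype α] (f : α → ℝ) : 0 ≤ 𝔼 x, f x ^ 2 :=
  Finset.expect_nonneg fun _ _ => sq_nonneg _

theorem sq_expect_le {α : Type*} [Fintype α] [Nonempty α] (f : α → ℝ) :
    (𝔼 x, f x) ^ 2 ≤ 𝔼 x, f x ^ 2 := by
  have := expect_sub_sq f 0
  simp only [sub_zero] at this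
  rw [this]
  linarith [expect_sq_nonneg fun x => f x - 𝔼 y, f y]

theorem expect_sub_expect_sq_le {α : Type*} [Fintype α] [Nonempty α] (f : α → ℝ) (c : ℝ) :
    𝔼 x, (f x - 𝔼 y, f y) ^ 2 ≤ 𝔼 x, (f x - c) ^ 2 := by
  rw [expect_sub_sq f c]
  linarith [sq_nonneg (𝔼 y, f y - c)]

theorem expect_cons {D : ℕ} {β : Type*} [Fintype β] (F : (Fin (D + 1) → β) → ℝ) :
    𝔼 H, F H = 𝔼 b, 𝔼 H : Fin D → β, F (Fin.cons b H) := by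
  rw [← Finset.expect_product', Finset.univ_product_univ]
  exact (Fintype.expect_equiv (Fin.consEquiv fun _ => β) _ _ fun x => rfl).symm

/-- The Efron-Stein inequality: the variance of a function of independent uniform coordinates is at
most the sum of the mean squared distances to functions `g j` that ignore coordinate `j`. -/
theorem efron_stein {D : ℕ} {β : Type*} [Fintype β] [Nonempty β] (F : (Fin D → β) → ℝ)
    (g : Fin D → (Fin D → β) → ℝ) (hg : ∀ j H b, g j (Function.update H j b) = g j H) :
    𝔼 H, (F H - 𝔼 K, F K) ^ 2 ≤ ∑ j, 𝔼 H, (F H - g j H) ^ 2 := by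
  induction D with
  | zero =>
    have : ∀ H : Fin 0 → β, F H = F default := fun H => by rw [Subsingleton.elim H default]
    simp [this]
  | succ D ih =>
    obtain ⟨b₀⟩ := ‹Nonempty β›
    have : Nonempty β := ⟨b₀⟩
    set M : β → ℝ := fun b => 𝔼 H : Fin D → β, F (Fin.cons b H) with hM
    have hmean : 𝔼 K, F K = 𝔼 b, M b := expect_cons F
    have hinner : 𝔼 b, 𝔼 H : Fin D → β, (F (Fin.cons b H) - M b) ^ 2
        ≤ ∑ j : Fin D, 𝔼 H, (F H - g j.succ H) ^ 2 := by
      simp only [expect_cons fun H => (F H - g _ H) ^ 2]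
      rw [← Finset.expect_sum_comm]
      refine Finset.expect_le_expect fun b _ => ?_
      refine ih (fun H => F (Fin.cons b H)) (fun j H => g j.succ (Fin.cons b H)) fun j H c => ?_
      rw [Fin.cons_update, hg]
    -- The mean over `b` minimizes the squared distance, and `g 0` gives a constant competitor.
    have houter : 𝔼 b, (M b - 𝔼 c, M c) ^ 2 ≤ 𝔼 H, (F H - g 0 H) ^ 2 := by
      refine (expect_sub_expect_sq_le M (𝔼 H : Fin D → β, g 0 (Fin.cons b₀ H))).trans ?_
      rw [expect_cons fun H => (F H - g 0 H) ^ 2]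
      refine Finset.expect_le_expect fun b _ => ?_
      have h0 : ∀ H : Fin D → β, g 0 (Fin.cons b₀ H) = g 0 (Fin.cons b H) := by
        intro H
        rw [← hg 0 (Fin.cons b₀ H) b, Fin.update_cons_zero]
      simp only [h0, hM]
      rw [← Finset.expect_sub_distrib]
      exact sq_expect_le _
    rw [Fin.sum_univ_succ, hmean, expect_cons]
    have hsplit : ∀ b, 𝔼 H : Fin D → β, (F (Fin.cons b H) - 𝔼 c, M c) ^ 2
        = 𝔼 H : Fin D → β, (F (Fin.cons b H) - M b) ^ 2 + (M b - 𝔼 c, M c) ^ 2 :=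
      fun b => expect_sub_sq (fun H : Fin D → β => F (Fin.cons b H)) _
    simp only [hsplit, Finset.expect_add_distrib]
    linarith

/-- Resampling one coordinate preserves the uniform distribution. -/
theorem expect_update {ι β : Type*} [Fintype ι] [DecidableEq ι] [Fintype β] (i : ι)
    (F : (ι → β) → ℝ) : 𝔼 H : ι → β, 𝔼 b, F (Function.update H i b) = 𝔼 H, F H := by
  cases isEmpty_or_nonempty β
  · have : IsEmpty (ι → β) := ⟨fun H => isEmptyElim (H i)⟩
    simp [Finset.univ_eq_empty]
  have h : 𝔼 H, F H = 𝔼 H, 𝔼 _b : β, F H := by simp only [Fintype.expect_const]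
  rw [h, ← Finset.expect_product', ← Finset.expect_product', Finset.univ_product_univ]
  have hinv : Function.Involutive
      fun x : (ι → β) × β => (Function.update x.1 i x.2, x.1 i) := by
    rintro ⟨H, b⟩
    simp
  exact Fintype.expect_equiv (hinv.toPerm) _ _ fun x => rfl

/-! ### Random hashing -/

theorem integral_hashLaw {D B : ℕ} (F : (Fin D → Fin B) → ℝ) :
    ∫ H, F H ∂(hashLaw D B) = 𝔼 H, F H := by
  unfold hashLaw ProbabilityTheory.uniformOn ProbabilityTheory.cond
  rw [Measure.restrict_univ, integral_smul_measure, integral_count, Fintype.expect_eq_sum_div_card]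
  simp [div_eq_inv_mul]

theorem gammaMap_eq {D B : ℕ} (m : Fin D → ℕ) (r : ℕ) :
    gammaMap B m r = 𝔼 H : Fin D → Fin B, (cumPrev (reduce H m) r : ℝ) := by
  unfold gammaMap
  rw [integral_hashLaw]
  simp only [cumPrev_anonymize]

/-- The mean load that the other items put on the bucket of item `j`. -/
theorem expect_load_le {D B : ℕ} {w : Fin D → ℕ} {j : Fin D} (hw : w j = 0) :
    𝔼 H : Fin D → Fin B, (reduce H w (H j) : ℝ) ≤ (∑ i, w i : ℕ) / (B : ℝ) := by
  simp only [reduce_eq_sum_ite]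
  push_cast
  rw [Finset.expect_sum_comm, Finset.sum_div]
  refine Finset.sum_le_sum fun i _ => ?_
  by_cases hij : i = j
  · subst hij; simp [hw]
  rw [← expect_update i]
  have : ∀ (H : Fin D → Fin B), 𝔼 b, (if Function.update H i b i = Function.update H i b j
      then (w i : ℝ) else 0) = w i / B := by
    intro H
    rw [Fintype.expect_eq_sum_div_card]
    simp [Function.update_of_ne (Ne.symm hij)]
  simp only [this]
  cases isEmpty_or_nonempty (Fin D → Fin B)
  · simp [Finset.univ_eq_empty]; positivity
  · rw [Fintype.expect_const]

/-- Concentration of the reduced histogram: the cumulative prevalences deviate from their means only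
through collisions, and item `j` collides with a mean load of at most `n / B`. -/
theorem sum_mul_variance_cumPrev_reduce_le {n D B : ℕ} (hB : 0 < B) {h : Fin D → ℕ}
    (hn : ∑ j, h j = n) :
    ∑ r ∈ Finset.Icc 1 n, (r : ℝ) * 𝔼 H : Fin D → Fin B,
      ((cumPrev (reduce H h) r : ℝ) - gammaMap B h r) ^ 2 ≤ 3 * (n : ℝ) ^ 2 / B := by
  have : Nonempty (Fin B) := ⟨⟨0, hB⟩⟩
  set w : Fin D → Fin D → ℕ := fun j => Function.update h j 0 with hwdef
  have hw0 : ∀ j, w j j = 0 := fun j => by simp [hwdef]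
  have hup : ∀ j, Function.update (w j) j (h j) = h := fun j => by simp [hwdef]
  have hsum : ∀ j, ∑ i, w j i + h j = n := by
    intro j
    rw [← hn, hwdef, Finset.sum_update_of_mem (Finset.mem_univ j), zero_add, add_comm,
      Finset.sdiff_singleton_eq_erase]
    exact Finset.add_sum_erase _ _ (Finset.mem_univ j)
  set L : Fin D → (Fin D → Fin B) → ℕ := fun j H => reduce H (w j) (H j) with hL
  have hLn : ∀ j H, L j H + h j ≤ n := by
    intro j H
    rw [← hsum j, ← sum_reduce H (w j)]
    exact Nat.add_le_add_right
      (Finset.single_le_sum (f := fun b => reduce H (w j) b) (fun _ _ => Nat.zero_le _)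
        (Finset.mem_univ (H j))) _
  have hES : ∀ r, 𝔼 H : Fin D → Fin B, ((cumPrev (reduce H h) r : ℝ) - gammaMap B h r) ^ 2
      ≤ ∑ j, 𝔼 H, (thr r (L j H + h j) - thr r (L j H) - thr r (h j)) ^ 2 := by
    intro r
    rw [gammaMap_eq]
    refine (efron_stein (fun H : Fin D → Fin B => (cumPrev (reduce H h) r : ℝ))
      (fun j H => cumPrev (reduce H (w j)) r + thr r (h j)) ?_).trans_eq ?_
    · intro j H b
      congr 3
      funext c
      rw [reduce_eq_sum_ite, reduce_eq_sum_ite]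
      refine Finset.sum_congr rfl fun i _ => ?_
      by_cases hij : i = j
      · subst hij; simp [hw0]
      · simp [hij]
    · refine Finset.sum_congr rfl fun j _ => Finset.expect_congr rfl fun H _ => ?_
      have := cumPrev_reduce_update H (hw0 j) (h j) r
      rw [hup] at this
      rw [this]
      ring
  calc _ ≤ ∑ r ∈ Finset.Icc 1 n, (r : ℝ) *
        ∑ j, 𝔼 H, (thr r (L j H + h j) - thr r (L j H) - thr r (h j)) ^ 2 :=
        Finset.sum_le_sum fun r _ => mul_le_mul_of_nonneg_left (hES r) (by positivity)
    _ = ∑ j, 𝔼 H, ∑ r ∈ Finset.Icc 1 n,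
        (r : ℝ) * (thr r (L j H + h j) - thr r (L j H) - thr r (h j)) ^ 2 := by
        simp only [Finset.mul_sum, Finset.mul_expect]
        rw [Finset.sum_comm]
        simp only [Finset.expect_sum_comm]
    _ ≤ ∑ j, 𝔼 H, (3 * h j * (L j H : ℝ)) :=
        Finset.sum_le_sum fun j _ => Finset.expect_le_expect fun H _ =>
          (sum_mul_collision_sq_le (hLn j H)).trans_eq (by ring)
    _ ≤ ∑ j, 3 * h j * ((n : ℝ) / B) := by
        refine Finset.sum_le_sum fun j _ => ?_
        rw [← Finset.mul_expect]
        refine mul_le_mul_of_nonneg_left ((expect_load_le (hw0 j)).trans ?_) (by positivity)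
        have := hsum j
        gcongr
        omega
    _ = 3 * (n : ℝ) ^ 2 / B := by
        rw [← Finset.sum_mul, ← Finset.mul_sum, ← Nat.cast_sum, hn]
        ring

/-- Without collisions hashing would preserve all cumulative prevalences; replacing the entry `j`
changes the mean defect by at most twice the change times the mean load on the bucket of `j`. -/
theorem sum_abs_defect_update_le {n D B : ℕ} (hB : 0 < B) {w : Fin D → ℕ} {j : Fin D} (hw : w j = 0)
    (a a' : ℕ) :
    ∑ r ∈ Finset.Icc 1 n,
      |(gammaMap B (Function.update w j a) r - cumPrev (Function.update w j a) r) -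
        (gammaMap B (Function.update w j a') r - cumPrev (Function.update w j a') r)| ≤
      2 * ((∑ i, w i : ℕ) / (B : ℝ)) * |(a : ℝ) - a'| := by
  have : Nonempty (Fin B) := ⟨⟨0, hB⟩⟩
  have hc : ∀ c r, (cumPrev (Function.update w j c) r : ℝ) =
      ∑ i ∈ Finset.univ.erase j, thr r (w i) + thr r c := by
    intro c r
    rw [cumPrev_eq_sum, ← Finset.add_sum_erase _ _ (Finset.mem_univ j), add_comm]
    congr 1
    · refine Finset.sum_congr rfl fun i hi => ?_
      rw [Function.update_of_ne (Finset.ne_of_mem_erase hi)]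
    · simp
  set L : (Fin D → Fin B) → ℕ := fun H => reduce H w (H j) with hL
  have hterm : ∀ r,
      (gammaMap B (Function.update w j a) r - cumPrev (Function.update w j a) r) -
        (gammaMap B (Function.update w j a') r - cumPrev (Function.update w j a') r)
      = 𝔼 H, ((thr r (L H + a) - thr r (L H + a')) - (thr r a - thr r a')) := by
    intro r
    rw [gammaMap_eq, gammaMap_eq, hc, hc]
    simp only [cumPrev_reduce_update _ hw, Finset.expect_sub_distrib, Finset.expect_add_distrib,
      Fintype.expect_const]
    ring
  calc _ ≤ ∑ r ∈ Finset.Icc 1 n,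
        𝔼 H, |(thr r (L H + a) - thr r (L H + a')) - (thr r a - thr r a')| := by
        refine Finset.sum_le_sum fun r _ => ?_
        rw [hterm]
        exact Finset.abs_expect_le _ _
    _ = 𝔼 H, ∑ r ∈ Finset.Icc 1 n,
        |(thr r (L H + a) - thr r (L H + a')) - (thr r a - thr r a')| :=
        (Finset.expect_sum_comm _ _ _).symm
    _ ≤ 𝔼 H, (2 * |(a : ℝ) - a'| * (L H : ℝ)) := by
        refine Finset.expect_le_expect fun H _ => ?_
        rcases Nat.eq_zero_or_pos (L H) with h0 | h0
        · simp [h0]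
        · have h1 : ∑ r ∈ Finset.Icc 1 n,
              |(thr r (L H + a) - thr r (L H + a')) - (thr r a - thr r a')| ≤
              2 * |(a : ℝ) - a'| := by
            refine (Finset.sum_le_sum fun r _ => abs_sub _ _).trans ?_
            rw [Finset.sum_add_distrib]
            have h2 := sum_abs_thr_sub_le n (L H + a) (L H + a')
            have h3 := sum_abs_thr_sub_le n a a'
            push_cast at h2
            rw [add_sub_add_left_eq_sub] at h2
            linarith
          refine h1.trans (le_mul_of_one_le_right (by positivity) ?_)
          exact_mod_cast h0
    _ ≤ _ := by
        rw [← Finset.mul_expect]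
        have := mul_le_mul_of_nonneg_left (expect_load_le (B := B) hw)
          (by positivity : (0:ℝ) ≤ 2 * |(a : ℝ) - a'|)
        linarith

/-- `Γ` is stably invertible on sorted histograms when the load factor `n / B` is small: it is a
perturbation of the isometry `m ↦ φ_≥(m)` with Lipschitz constant `4 n / B`. -/
theorem l1Dist_le_l1Upto_gammaMap {n D B : ℕ} (hB : 0 < B) {m m' : Fin D → ℕ} (hm : Antitone m)
    (hm' : Antitone m') (hn : ∑ j, m j = n) (hn' : ∑ j, m' j = n) :
    (1 - 4 * n / (B : ℝ)) * l1Dist m m' ≤ l1Upto n (gammaMap B m) (gammaMap B m') := by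
  have hle : ∀ {v : Fin D → ℕ}, ∑ j, v j = n → ∀ j, v j ≤ n := fun hv j =>
    hv ▸ Finset.single_le_sum (fun _ _ => Nat.zero_le _) (Finset.mem_univ j)
  set δ : (Fin D → ℕ) → ℕ → ℝ := fun v r => gammaMap B v r - cumPrev v r with hδ
  -- Pass from `m'` to `m` one coordinate at a time; every hybrid has total count at most `2 * n`.
  have key : ∀ S : Finset (Fin D), l1Upto n (δ (S.piecewise m m')) (δ m') ≤
      4 * n / (B : ℝ) * ∑ j ∈ S, |(m j : ℝ) - m' j| := by
    intro S
    induction S using Finset.induction_on with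
    | empty => simp [l1Upto]
    | insert j S hj ih =>
      set v : Fin D → ℕ := S.piecewise m m' with hv
      set w : Fin D → ℕ := Function.update v j 0 with hw
      have h1 : (insert j S).piecewise m m' = Function.update w j (m j) := by
        rw [Finset.piecewise_insert, hw, Function.update_idem]
      have h2 : v = Function.update w j (m' j) := by
        rw [hw, Function.update_idem]
        have : m' j = v j := by simp [hv, hj]
        rw [this, Function.update_eq_self]
      have hws : ∑ i, w i ≤ 2 * n := by
        calc ∑ i, w i ≤ ∑ i, (m i + m' i) := by
              refine Finset.sum_le_sum fun i _ => ?_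
              by_cases hi : i = j
              · subst hi; simp [hw]
              · rw [hw, Function.update_of_ne hi, hv]
                by_cases hS : i ∈ S <;> simp [hS]
          _ = 2 * n := by rw [Finset.sum_add_distrib, hn, hn']; ring
      have h3 := sum_abs_defect_update_le (n := n) hB (w := w) (j := j) (by simp [hw])
        (m j) (m' j)
      rw [← h1, ← h2] at h3
      have h4 : 2 * ((∑ i, w i : ℕ) / (B : ℝ)) ≤ 4 * n / (B : ℝ) := by
        rw [← mul_div_assoc]
        refine div_le_div_of_nonneg_right ?_ (Nat.cast_nonneg _)
        have : ((∑ i, w i : ℕ) : ℝ) ≤ 2 * n := by exact_mod_cast hws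
        linarith
      have h5 := mul_le_mul_of_nonneg_right h4 (abs_nonneg ((m j : ℝ) - m' j))
      rw [Finset.sum_insert hj, mul_add]
      refine (l1Upto_triangle n _ (δ v) _).trans (add_le_add (le_trans ?_ h5) ih)
      exact h3
  have h1 := key Finset.univ
  rw [Finset.piecewise_univ] at h1
  have h2 := l1Dist_eq_l1Upto hm hm' (hle hn) (hle hn')
  have h3 : l1Upto n (fun r => (cumPrev m r : ℝ)) (fun r => (cumPrev m' r : ℝ)) ≤
      l1Upto n (gammaMap B m) (gammaMap B m') + l1Upto n (δ m) (δ m') := by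
    unfold l1Upto
    rw [← Finset.sum_add_distrib]
    refine Finset.sum_le_sum fun r _ => ?_
    have : (cumPrev m r : ℝ) - cumPrev m' r
        = (gammaMap B m r - gammaMap B m' r) - (δ m r - δ m' r) := by simp only [hδ]; ring
    rw [this]
    exact abs_sub _ _
  have h4 : ∑ j, |(m j : ℝ) - m' j| = l1Dist m m' := rfl
  rw [h4] at h1
  linarith

/-! ### Moments of the discrete Laplace distribution -/

theorem dLap_singleton (p : ℝ) (i : ℤ) :
    dLap p {i} = ENNReal.ofReal ((1 - p) / (1 + p) * p ^ i.natAbs) := by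
  unfold dLap
  rw [withDensity_apply _ (measurableSet_singleton i), Measure.restrict_singleton,
    lintegral_smul_measure, lintegral_dirac, Measure.count_singleton, one_smul]

theorem hasSum_dLap_mass {p : ℝ} (hp : 0 < p) (hp1 : p < 1) :
    HasSum (fun i : ℤ => (1 - p) / (1 + p) * p ^ i.natAbs) 1 := by
  have hg := hasSum_geometric_of_lt_one hp.le hp1
  have h1 : HasSum (fun n : ℕ => (1 - p) / (1 + p) * p ^ (n : ℤ).natAbs)
      ((1 - p) / (1 + p) * (1 - p)⁻¹) := hg.mul_left _
  have h2 : HasSum (fun n : ℕ => (1 - p) / (1 + p) * p ^ (-((n : ℤ) + 1)).natAbs)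
      ((1 - p) / (1 + p) * p * (1 - p)⁻¹) := by
    refine (iff_of_eq (congrArg (HasSum · _) (funext fun n => ?_))).1
      (hg.mul_left ((1 - p) / (1 + p) * p))
    have : (-((n : ℤ) + 1)).natAbs = n + 1 := by omega
    rw [this, pow_succ]
    ring
  have h3 : (1 - p) / (1 + p) * (1 - p)⁻¹ + (1 - p) / (1 + p) * p * (1 - p)⁻¹ = 1 := by
    have : 1 - p ≠ 0 := by linarith
    have : 1 + p ≠ 0 := by linarith
    field_simp
  have h4 := h1.of_nat_of_neg_add_one (f := fun i : ℤ => (1 - p) / (1 + p) * p ^ i.natAbs) h2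
  rwa [h3] at h4

theorem isProbabilityMeasure_dLap {p : ℝ} (hp : 0 < p) (hp1 : p < 1) :
    IsProbabilityMeasure (dLap p) := by
  have hnn : ∀ i : ℤ, 0 ≤ (1 - p) / (1 + p) * p ^ i.natAbs := fun i => by
    have : 0 ≤ 1 - p := by linarith
    positivity
  have h := hasSum_dLap_mass hp hp1
  constructor
  rw [← Measure.tsum_indicator_apply_singleton _ _ MeasurableSet.univ]
  simp only [Set.indicator_univ, dLap_singleton]
  rw [← ENNReal.ofReal_tsum_of_nonneg hnn h.summable, h.tsum_eq, ENNReal.ofReal_one]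

theorem integral_dLap {p : ℝ} (hp : 0 < p) (hp1 : p < 1) {g : ℤ → ℝ} {C s : ℝ}
    (hg : ∀ i, |g i| ≤ C) (hs : HasSum (fun i : ℤ => (1 - p) / (1 + p) * p ^ i.natAbs * g i) s) :
    ∫ i, g i ∂(dLap p) = s := by
  have := isProbabilityMeasure_dLap hp hp1
  rw [integral_countable (Integrable.of_bound (Measurable.of_discrete).aestronglyMeasurable C
    (Filter.Eventually.of_forall hg)), ← hs.tsum_eq]
  refine tsum_congr fun i => ?_
  have : 0 ≤ 1 - p := by linarith
  rw [measureReal_def, dLap_singleton, ENNReal.toReal_ofReal (by positivity), smul_eq_mul]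

theorem abs_postF_le {p : ℝ} (hp : 0 < p) (m : ℤ) : |postF p m| ≤ 1 + p / (1 - p) ^ 2 := by
  have : 0 ≤ p / (1 - p) ^ 2 := by positivity
  unfold postF
  split_ifs
  · rw [abs_one]; linarith
  · rw [abs_of_nonneg (by linarith)]
  · rw [abs_neg, abs_of_nonneg this]; linarith
  · rw [abs_zero]; linarith

/-- The post-processing function is self-dual, as is the indicator of the nonnegative integers. -/
theorem postF_symm (p : ℝ) (m : ℤ) : postF p (-m - 1) = 1 - postF p m := by
  unfold postF
  split_ifs <;> first | omega | ring

/-- Below zero only the values `-1`, `0` and the positive tail of the post-processing function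
contribute; `G` is the identity for the mean and the square for the second moment. -/
theorem hasSum_postF_neg {p : ℝ} (hp : 0 < p) (hp1 : p < 1) {G : ℝ → ℝ} (hG : G 0 = 0) (k : ℕ) :
    HasSum (fun i : ℤ => (1 - p) / (1 + p) * p ^ i.natAbs * G (postF p (i - (k + 1))))
      ((1 - p) / (1 + p) * p ^ k * (G (-(p / (1 - p) ^ 2)) + p * G (1 + p / (1 - p) ^ 2) +
        p ^ 2 / (1 - p) * G 1)) := by
  have hinj : Function.Injective fun t : ℕ => (k : ℤ) + t := fun a b h => by
    simpa using h
  rw [← hinj.hasSum_iff]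
  · rw [← hasSum_nat_add_iff' 2]
    have hsum : (1 - p) / (1 + p) * p ^ k * (G (-(p / (1 - p) ^ 2)) +
        p * G (1 + p / (1 - p) ^ 2) + p ^ 2 / (1 - p) * G 1) -
        ∑ t ∈ Finset.range 2, ((fun i : ℤ => (1 - p) / (1 + p) * p ^ i.natAbs *
          G (postF p (i - (k + 1)))) ∘ fun t : ℕ => (k : ℤ) + t) t
        = (1 - p) / (1 + p) * p ^ k * p ^ 2 * G 1 * (1 - p)⁻¹ := by
      have h0 : postF p ((k : ℤ) + (0 : ℕ) - (k + 1)) = -(p / (1 - p) ^ 2) := by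
        have : (k : ℤ) + (0 : ℕ) - (k + 1) = -1 := by push_cast; ring
        rw [this]
        simp [postF]
      have h1 : postF p ((k : ℤ) + (1 : ℕ) - (k + 1)) = 1 + p / (1 - p) ^ 2 := by
        have : (k : ℤ) + (1 : ℕ) - (k + 1) = 0 := by push_cast; ring
        rw [this]
        simp [postF]
      have h2 : ((k : ℤ) + (0 : ℕ)).natAbs = k := by omega
      have h3 : ((k : ℤ) + (1 : ℕ)).natAbs = k + 1 := by omega
      simp only [Finset.sum_range_succ, Finset.sum_range_zero, Function.comp, h0, h1, h2, h3]
      ring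
    rw [hsum]
    refine (iff_of_eq (congrArg (HasSum · _) (funext fun t => ?_))).1
      ((hasSum_geometric_of_lt_one hp.le hp1).mul_left ((1 - p) / (1 + p) * p ^ k * p ^ 2 * G 1))
    have h1 : ((k : ℤ) + ((t + 2 : ℕ) : ℤ)).natAbs = k + t + 2 := by omega
    have h2 : (k : ℤ) + ((t + 2 : ℕ) : ℤ) - (k + 1) = t + 1 := by push_cast; ring
    simp only [Function.comp, h1, h2]
    rw [postF, if_pos (by positivity)]
    ring
  · intro i hi
    have : i < k := by
      by_contra h
      exact hi ⟨(i - k).toNat, by simp; omega⟩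
    rw [postF, if_neg (by omega), if_neg (by omega), if_neg (by omega), hG, mul_zero]

/-- The post-processing function inverts the noise: `postF p (m + ξ)` is an unbiased estimate of the
indicator of `0 ≤ m`, with a variance that decays geometrically in `|m|`. -/
theorem postF_moments {p : ℝ} (hp : 0 < p) (hp1 : p < 1) (m : ℤ) :
    ∫ i, (postF p (m + i) - if 0 ≤ m then 1 else 0) ∂(dLap p) = 0 ∧
    ∫ i, (postF p (m + i) - if 0 ≤ m then 1 else 0) ^ 2 ∂(dLap p) ≤
      3 * p ^ m.natAbs / (1 - p) ^ 3 := by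
  set c := p / (1 - p) ^ 2 with hc
  have hq : 0 < 1 - p := by linarith
  have hc0 : 0 ≤ c := by positivity
  have hbd : ∀ k i : ℤ, |postF p (i - k)| ≤ 1 + c := fun k i => abs_postF_le hp _
  have hbd2 : ∀ k i : ℤ, |postF p (i - k) ^ 2| ≤ (1 + c) ^ 2 := fun k i => by
    rw [abs_pow]
    exact pow_le_pow_left₀ (abs_nonneg _) (hbd k i) 2
  have hfirst : ∀ k : ℕ, (1 - p) / (1 + p) * p ^ k * (-c + p * (1 + c) + p ^ 2 / (1 - p) * 1)
      = 0 := by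
    intro k
    rw [hc]
    field_simp
    ring
  have hsecond : ∀ k : ℕ, (1 - p) / (1 + p) * p ^ k *
      ((-c) ^ 2 + p * (1 + c) ^ 2 + p ^ 2 / (1 - p) * 1 ^ 2) ≤ 3 * p ^ (k + 1) / (1 - p) ^ 3 := by
    intro k
    have h1 : (-c) ^ 2 + p * (1 + c) ^ 2 + p ^ 2 / (1 - p) * 1 ^ 2
        = p * (p + ((1 - p) ^ 2 + p) ^ 2 + p * (1 - p) ^ 3) / (1 - p) ^ 4 := by
      rw [hc]
      field_simp
    have h2 : p + ((1 - p) ^ 2 + p) ^ 2 + p * (1 - p) ^ 3 ≤ 3 := by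
      have h3 : (1 - p) ^ 2 + p ≤ 1 := by nlinarith
      have h4 : ((1 - p) ^ 2 + p) ^ 2 ≤ 1 := pow_le_one₀ (by positivity) h3
      have h5 : p * (1 - p) ^ 3 ≤ 1 :=
        mul_le_one₀ hp1.le (by positivity) (pow_le_one₀ hq.le (by linarith))
      linarith
    rw [h1]
    have h6 : (1 - p) / (1 + p) * p ^ k *
        (p * (p + ((1 - p) ^ 2 + p) ^ 2 + p * (1 - p) ^ 3) / (1 - p) ^ 4)
        = (p + ((1 - p) ^ 2 + p) ^ 2 + p * (1 - p) ^ 3) / (1 + p) * (p ^ (k + 1) / (1 - p) ^ 3) := by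
      field_simp
      ring
    rw [h6, mul_div_assoc]
    refine mul_le_mul_of_nonneg_right ?_ (by positivity)
    rw [div_le_iff₀ (by linarith)]
    linarith
  have hneg1 : ∀ k : ℕ, HasSum (fun i : ℤ => (1 - p) / (1 + p) * p ^ i.natAbs *
      postF p (i - (k + 1))) 0 := fun k => by
    have := hasSum_postF_neg hp hp1 (G := id) rfl k
    simp only [id, ← hc, hfirst] at this
    exact this
  have hneg2 : ∀ k : ℕ, HasSum (fun i : ℤ => (1 - p) / (1 + p) * p ^ i.natAbs *
      postF p (i - (k + 1)) ^ 2) _ := fun k =>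
    hasSum_postF_neg hp hp1 (G := fun x => x ^ 2) (by norm_num) k
  -- By the symmetry of the noise and `postF_symm`, the case `0 ≤ m` reduces to `-m - 1 < 0`.
  rcases lt_or_ge m 0 with hm | hm
  · obtain ⟨k, rfl⟩ : ∃ k : ℕ, m = -((k : ℤ) + 1) := ⟨(-m - 1).toNat, by omega⟩
    have h1 : ∀ i : ℤ, -((k : ℤ) + 1) + i = i - (k + 1) := fun i => by ring
    have h2 : (-((k : ℤ) + 1)).natAbs = k + 1 := by omega
    simp only [h1, if_neg (not_le.2 hm), sub_zero, h2]
    refine ⟨integral_dLap hp hp1 (hbd _) (hneg1 k), ?_⟩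
    rw [integral_dLap hp hp1 (hbd2 _) (hneg2 k)]
    exact hsecond k
  · obtain ⟨k, rfl⟩ := Int.eq_ofNat_of_zero_le hm
    have h1 : ∀ i : ℤ, postF p ((k : ℤ) + i) - 1 = -postF p (-i - (k + 1)) := fun i => by
      have := postF_symm p ((k : ℤ) + i)
      have h2 : -((k : ℤ) + i) - 1 = -i - (k + 1) := by ring
      rw [h2] at this
      rw [this]
      ring
    simp only [if_pos hm, h1, neg_sq, Int.natAbs_natCast]
    have hneg1' : HasSum (fun i : ℤ => (1 - p) / (1 + p) * p ^ i.natAbs *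
        -postF p (-i - (k + 1))) 0 := by
      have := ((Equiv.neg ℤ).hasSum_iff.2 (hneg1 k)).neg
      simpa [Function.comp_def] using this
    have hneg2' := (Equiv.neg ℤ).hasSum_iff.2 (hneg2 k)
    simp only [Function.comp_def, Equiv.neg_apply, Int.natAbs_neg] at hneg2'
    refine ⟨integral_dLap hp hp1 (C := 1 + c) (fun i => ?_) hneg1', ?_⟩
    · rw [abs_neg]
      exact hbd _ _
    · rw [integral_dLap hp hp1 (fun i => hbd2 _ _) hneg2']
      refine (hsecond k).trans ?_
      gcongr 3 * ?_ / _
      exact pow_le_pow_of_le_one hp.le hp1.le (by omega)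

/-! ### The noised reduced histogram -/

theorem integral_phiHat_sub_sq_le {B : ℕ} {p : ℝ} (hp : 0 < p) (hp1 : p < 1) (a : Fin B → ℕ)
    (r : ℕ) :
    ∫ w : Fin B → ℤ, (phiHat p (fun b => (a b : ℤ) + w b) r - cumPrev a r) ^ 2
        ∂(Measure.pi fun _ : Fin B => dLap p) ≤
      ∑ b, 3 * p ^ ((a b : ℤ) - r).natAbs / (1 - p) ^ 3 := by
  have := isProbabilityMeasure_dLap hp hp1
  set X : Fin B → ℤ → ℝ := fun b i =>
    postF p ((a b : ℤ) - r + i) - if 0 ≤ (a b : ℤ) - r then 1 else 0 with hX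
  have hXm := fun b => postF_moments hp hp1 ((a b : ℤ) - r)
  have hXb : ∀ b i, |X b i| ≤ 1 + p / (1 - p) ^ 2 + 1 := by
    intro b i
    refine (abs_sub _ _).trans (add_le_add (abs_postF_le hp _) ?_)
    split_ifs <;> simp
  have hmem : ∀ b, MemLp (X b) 2 (dLap p) := fun b =>
    MemLp.of_bound (Measurable.of_discrete).aestronglyMeasurable _
      (Filter.Eventually.of_forall (hXb b))
  have hint : ∀ b, Integrable (fun w : Fin B → ℤ => X b (w b))
      (Measure.pi fun _ : Fin B => dLap p) := fun b =>
    Integrable.of_bound (Measurable.of_discrete).aestronglyMeasurable _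
      (Filter.Eventually.of_forall fun w => hXb b (w b))
  have hdiff : ∀ w : Fin B → ℤ, phiHat p (fun b => (a b : ℤ) + w b) r - cumPrev a r
      = (∑ b, fun w : Fin B → ℤ => X b (w b)) w := by
    intro w
    rw [cumPrev_eq_sum, phiHat, ← Finset.sum_sub_distrib, Finset.sum_apply]
    refine Finset.sum_congr rfl fun b _ => ?_
    simp only [hX, thr]
    congr 1
    · congr 1; ring
    · simp
  simp only [hdiff]
  rw [← ProbabilityTheory.variance_of_integral_eq_zero]
  · rw [ProbabilityTheory.variance_sum_pi hmem]
    refine Finset.sum_le_sum fun b _ => ?_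
    rw [ProbabilityTheory.variance_of_integral_eq_zero (Measurable.of_discrete).aemeasurable
      (hXm b).1]
    exact (hXm b).2
  · exact (Measurable.of_discrete).aemeasurable
  · simp only [Finset.sum_apply]
    rw [integral_finsetSum _ fun b _ => hint b]
    refine Finset.sum_eq_zero fun b _ => ?_
    rw [integral_comp_eval (μ := fun _ : Fin B => dLap p) (i := b) (f := X b)
      (Measurable.of_discrete).aestronglyMeasurable]
    exact (hXm b).1

/-- Each distance to `h` is attained at most twice, and `r ≤ h + |r - h|`. -/
theorem sum_mul_pow_dist_le {p : ℝ} (hp : 0 < p) (hp1 : p < 1) (n h : ℕ) :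
    ∑ r ∈ Finset.Icc 1 n, (r : ℝ) * p ^ ((h : ℤ) - r).natAbs ≤ 2 * (h + 1) / (1 - p) ^ 2 := by
  have hq : 0 < 1 - p := by linarith
  have hs : HasSum (fun t : ℕ => ((h : ℝ) + t) * p ^ t) (h * (1 - p)⁻¹ + p / (1 - p) ^ 2) := by
    simp only [add_mul]
    exact ((hasSum_geometric_of_lt_one hp.le hp1).mul_left _).add
      (hasSum_coe_mul_geometric_of_norm_lt_one (by rwa [Real.norm_of_nonneg hp.le]))
  have hpart : ∀ S : Finset ℕ, Set.InjOn (fun r : ℕ => ((h : ℤ) - r).natAbs) S →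
      ∑ r ∈ S, (r : ℝ) * p ^ ((h : ℤ) - r).natAbs ≤ (h + 1) / (1 - p) ^ 2 := by
    intro S hS
    calc ∑ r ∈ S, (r : ℝ) * p ^ ((h : ℤ) - r).natAbs
        ≤ ∑ r ∈ S, ((h : ℝ) + (((h : ℤ) - r).natAbs : ℕ)) * p ^ ((h : ℤ) - r).natAbs := by
          refine Finset.sum_le_sum fun r _ => mul_le_mul_of_nonneg_right ?_ (by positivity)
          exact_mod_cast (by omega : r ≤ h + ((h : ℤ) - r).natAbs)
      _ = ∑ t ∈ S.image fun r : ℕ => ((h : ℤ) - r).natAbs, ((h : ℝ) + t) * p ^ t :=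
          (Finset.sum_image (f := fun t : ℕ => ((h : ℝ) + t) * p ^ t) hS).symm
      _ ≤ h * (1 - p)⁻¹ + p / (1 - p) ^ 2 := sum_le_hasSum _ (fun _ _ => by positivity) hs
      _ ≤ (h + 1) / (1 - p) ^ 2 := by
          rw [add_div]
          refine add_le_add ?_ (by gcongr)
          rw [← div_eq_mul_inv]
          refine div_le_div_of_nonneg_left (by positivity) (by positivity) ?_
          nlinarith
  rw [← Finset.sum_filter_add_sum_filter_not _ fun r => r ≤ h]
  have h1 := hpart ((Finset.Icc 1 n).filter fun r => r ≤ h) fun a ha b hb hab => by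
    simp only [Finset.coe_filter, Set.mem_ofPred_eq] at ha hb hab
    omega
  have h2 := hpart ((Finset.Icc 1 n).filter fun r => ¬ r ≤ h) fun a ha b hb hab => by
    simp only [Finset.coe_filter, Set.mem_ofPred_eq] at ha hb hab
    omega
  rw [two_mul, add_div]
  exact add_le_add h1 h2

/-- The weighted mean squared error that the noise causes in the estimate of the cumulative
prevalences of a histogram with total count `n`. -/
theorem sum_mul_integral_phiHat_le {n B : ℕ} {p : ℝ} (hp : 0 < p) (hp1 : p < 1) {a : Fin B → ℕ}
    (ha : ∑ b, a b = n) :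
    ∑ r ∈ Finset.Icc 1 n, (r : ℝ) *
      ∫ w : Fin B → ℤ, (phiHat p (fun b => (a b : ℤ) + w b) r - cumPrev a r) ^ 2
        ∂(Measure.pi fun _ : Fin B => dLap p) ≤ 6 * (n + B) / (1 - p) ^ 5 := by
  have hq : 0 < 1 - p := by linarith
  calc _ ≤ ∑ r ∈ Finset.Icc 1 n, (r : ℝ) *
        ∑ b, 3 * p ^ ((a b : ℤ) - r).natAbs / (1 - p) ^ 3 :=
        Finset.sum_le_sum fun r _ =>
          mul_le_mul_of_nonneg_left (integral_phiHat_sub_sq_le hp hp1 a r) (by positivity)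
    _ = 3 / (1 - p) ^ 3 * ∑ b, ∑ r ∈ Finset.Icc 1 n, (r : ℝ) * p ^ ((a b : ℤ) - r).natAbs := by
        simp only [Finset.mul_sum]
        rw [Finset.sum_comm]
        exact Finset.sum_congr rfl fun b _ => Finset.sum_congr rfl fun r _ => by ring
    _ ≤ 3 / (1 - p) ^ 3 * ∑ b, 2 * ((a b : ℝ) + 1) / (1 - p) ^ 2 := by
        gcongr with b
        exact sum_mul_pow_dist_le hp hp1 n (a b)
    _ = 6 * (n + B) / (1 - p) ^ 5 := by
        rw [← Finset.sum_div, ← Finset.mul_sum, Finset.sum_add_distrib, ← Nat.cast_sum, ha]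
        simp
        field_simp
        ring

/-! ### Privacy -/

theorem reduce_hist {n D B : ℕ} (H : Fin D → Fin B) (z : Fin n → Fin D) :
    reduce H (hist z) = hist (H ∘ z) := by
  funext b
  unfold reduce hist
  rw [Finset.sum_card_fiberwise_eq_card_filter]
  simp

/-- Changing one user moves one unit of count between two cells. -/
theorem sum_natAbs_hist_sub_le {n B : ℕ} {y y' : Fin n → Fin B} (h : Neighboring y y') :
    ∑ b, ((hist y b : ℤ) - hist y' b).natAbs ≤ 2 := by
  obtain ⟨i, hi⟩ := h
  have h1 : ∀ (x : Fin n → Fin B) b, (hist x b : ℤ) =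
      (if x i = b then 1 else 0) + ∑ j ∈ Finset.univ.erase i, if x j = b then 1 else 0 := by
    intro x b
    rw [Finset.add_sum_erase _ (fun j => if x j = b then (1 : ℤ) else 0) (Finset.mem_univ i)]
    simp [hist]
  have h2 : ∀ b, ((hist y b : ℤ) - hist y' b).natAbs ≤
      (if y i = b then 1 else 0) + (if y' i = b then 1 else 0) := by
    intro b
    have h3 : ∑ j ∈ Finset.univ.erase i, (if y j = b then (1 : ℤ) else 0)
        = ∑ j ∈ Finset.univ.erase i, if y' j = b then 1 else 0 :=
      Finset.sum_congr rfl fun j hj => by rw [hi j (Finset.ne_of_mem_erase hj)]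
    rw [h1, h1, h3, add_sub_add_right_eq_sub]
    split_ifs <;> simp
  refine (Finset.sum_le_sum fun b _ => h2 b).trans ?_
  rw [Finset.sum_add_distrib]
  simp

theorem pi_dLap_singleton {B : ℕ} {p : ℝ} (hp : 0 < p) (hp1 : p < 1) (w : Fin B → ℤ) :
    Measure.pi (fun _ : Fin B => dLap p) {w} =
      ENNReal.ofReal (∏ b, ((1 - p) / (1 + p) * p ^ (w b).natAbs)) := by
  have := isProbabilityMeasure_dLap hp hp1
  have hq : 0 ≤ 1 - p := by linarith
  rw [Measure.pi_singleton, ENNReal.ofReal_prod_of_nonneg fun _ _ => by positivity]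
  simp only [dLap_singleton]

/-- The noise hides a shift of the noised vector by a vector of `ℓ₁`-norm at most `d`. -/
theorem pi_dLap_shift_le {B d : ℕ} {p : ℝ} (hp : 0 < p) (hp1 : p < 1) {a a' : Fin B → ℤ}
    (h : ∑ b, (a b - a' b).natAbs ≤ d) (S : Set (Fin B → ℤ)) :
    Measure.pi (fun _ : Fin B => dLap p) {w | a + w ∈ S} ≤
      ENNReal.ofReal ((p ^ d)⁻¹) * Measure.pi (fun _ : Fin B => dLap p) {w | a' + w ∈ S} := by
  have := isProbabilityMeasure_dLap hp hp1
  have hq : 0 ≤ 1 - p := by linarith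
  set μ := Measure.pi (fun _ : Fin B => dLap p) with hμ
  have hsum : ∀ c : Fin B → ℤ, μ {w | c + w ∈ S} = ∑' y, S.indicator (fun y => μ {y - c}) y := by
    intro c
    rw [← Measure.tsum_indicator_apply_singleton _ _ (MeasurableSet.of_discrete),
      ← (Equiv.addLeft c).tsum_eq fun y => S.indicator (fun y => μ {y - c}) y]
    refine tsum_congr fun w => ?_
    by_cases hw : c + w ∈ S <;> simp [hw]
  rw [hsum, hsum, ← ENNReal.tsum_mul_left]
  refine ENNReal.tsum_le_tsum fun y => ?_
  by_cases hy : y ∈ S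
  · rw [Set.indicator_of_mem hy, Set.indicator_of_mem hy, hμ, pi_dLap_singleton hp hp1,
      pi_dLap_singleton hp hp1, ← ENNReal.ofReal_mul (by positivity)]
    refine ENNReal.ofReal_le_ofReal ?_
    rw [Finset.prod_mul_distrib, Finset.prod_mul_distrib, mul_left_comm]
    refine mul_le_mul_of_nonneg_left ?_ (Finset.prod_nonneg fun _ _ => by positivity)
    rw [Finset.prod_pow_eq_pow_sum, Finset.prod_pow_eq_pow_sum, inv_mul_eq_div,
      le_div_iff₀ (by positivity), ← pow_add]
    refine pow_le_pow_of_le_one hp.le hp1.le ?_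
    calc ∑ b, ((y - a') b).natAbs ≤ ∑ b, (((y - a) b).natAbs + (a b - a' b).natAbs) :=
          Finset.sum_le_sum fun b _ => by simp only [Pi.sub_apply]; omega
      _ ≤ _ := by rw [Finset.sum_add_distrib]; omega
  · simp [hy]

theorem isProbabilityMeasure_mechanism {n D B : ℕ} (hB : 0 < B) {p : ℝ} (hp : 0 < p) (hp1 : p < 1)
    (est : (Fin B → ℤ) → (Fin D → ℕ)) (z : Fin n → Fin D) :
    IsProbabilityMeasure (mechanism p est z) := by
  have := isProbabilityMeasure_dLap hp hp1
  have : Nonempty (Fin B) := ⟨⟨0, hB⟩⟩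
  have : IsProbabilityMeasure (hashLaw D B) :=
    ProbabilityTheory.isProbabilityMeasure_uniformOn Set.finite_univ Set.univ_nonempty
  exact Measure.isProbabilityMeasure_map (Measurable.of_discrete).aemeasurable

theorem isDP_mechanism {n D B : ℕ} (hB : 0 < B) {ε : ℝ} (hε : 0 < ε)
    (est : (Fin B → ℤ) → (Fin D → ℕ)) :
    IsDP ε fun z : Fin n → Fin D => mechanism (Real.exp (-ε / 2)) est z := by
  set p := Real.exp (-ε / 2) with hpdef
  have hp : 0 < p := Real.exp_pos _
  have hp1 : p < 1 := by
    rw [hpdef, ← Real.exp_zero]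
    exact Real.exp_lt_exp.2 (by linarith)
  have hexp : (p ^ 2)⁻¹ = Real.exp ε := by
    rw [hpdef, ← Real.exp_nat_mul, ← Real.exp_neg]
    congr 1
    push_cast
    ring
  have := isProbabilityMeasure_dLap hp hp1
  refine ⟨fun z => isProbabilityMeasure_mechanism hB hp hp1 est z, fun z z' hz E hE => ?_⟩
  rw [ENNReal.ofReal_zero, add_zero]
  have hsf : SFinite (hashLaw D B) := by
    unfold hashLaw ProbabilityTheory.uniformOn
    infer_instance
  unfold mechanism
  rw [Measure.map_apply Measurable.of_discrete hE, Measure.map_apply Measurable.of_discrete hE,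
    Measure.prod_apply MeasurableSet.of_discrete, Measure.prod_apply MeasurableSet.of_discrete,
    ← lintegral_const_mul _ Measurable.of_discrete]
  refine lintegral_mono fun H => ?_
  have hn : Neighboring (H ∘ z) (H ∘ z') := by
    obtain ⟨i, hi⟩ := hz
    exact ⟨i, fun j hj => congrArg H (hi j hj)⟩
  have h := pi_dLap_shift_le hp hp1 (a := fun b => (reduce H (hist z) b : ℤ))
    (a' := fun b => (reduce H (hist z') b : ℤ)) (d := 2)
    (by simpa only [reduce_hist] using sum_natAbs_hist_sub_le hn) (est ⁻¹' E)
  rw [hexp] at h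
  exact h

/-! ### Accuracy -/

/-- `Γ` does not depend on the order of the entries, so sorting may be undone before hashing. -/
theorem gammaMap_anonymize {D : ℕ} (B : ℕ) (h : Fin D → ℕ) (r : ℕ) :
    gammaMap B (anonymize h) r = gammaMap B h r := by
  rw [gammaMap_eq, gammaMap_eq]
  set σ : Fin D ≃ Fin D := Fin.revPerm.trans (Tuple.sort h) with hσ
  refine Fintype.expect_equiv (σ.arrowCongr (Equiv.refl (Fin B))) _ _ fun H => ?_
  congr 2
  funext b
  rw [reduce_eq_sum_ite, reduce_eq_sum_ite,
    ← Equiv.sum_comp σ fun j => if σ.arrowCongr (Equiv.refl (Fin B)) H j = b then h j else 0]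
  refine Finset.sum_congr rfl fun j _ => ?_
  have : σ.arrowCongr (Equiv.refl (Fin B)) H (σ j) = H j := by simp [Equiv.arrowCongr_apply]
  rw [this]
  rfl

theorem l1Dist_le {n D : ℕ} {m m' : Fin D → ℕ} (hm : ∑ j, m j = n) (hm' : ∑ j, m' j = n) :
    l1Dist m m' ≤ 2 * n := by
  calc l1Dist m m' ≤ ∑ j, ((m j : ℝ) + m' j) := by
        refine Finset.sum_le_sum fun j _ => (abs_sub _ _).trans_eq ?_
        rw [Nat.abs_cast, Nat.abs_cast]
    _ = 2 * n := by
        rw [Finset.sum_add_distrib, ← Nat.cast_sum, ← Nat.cast_sum, hm, hm']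
        ring

theorem l1Dist_nonneg {D : ℕ} (m m' : Fin D → ℕ) : 0 ≤ l1Dist m m' :=
  Finset.sum_nonneg fun _ _ => abs_nonneg _

/-- The error of the estimator is controlled by the noise and by the fluctuation of the reduced
histogram: the true histogram is a competitor in both minimizations, and `Γ` is stably
invertible. -/
theorem l1Dist_estimate_le {n D B : ℕ} (hB : 0 < B) (hnB : 8 * n ≤ B) {p : ℝ} {h : Fin D → ℕ}
    (hh : ∑ j, h j = n) (H : Fin D → Fin B) {w : Fin B → ℤ} {m : Fin D → ℕ}
    (hm : IsHashedEstimate p n w m) :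
    l1Dist m (anonymize h) ≤
      8 * l1Upto n (phiHat p w) (fun r => (cumPrev (reduce H h) r : ℝ)) +
      4 * l1Upto n (fun r => (cumPrev (reduce H h) r : ℝ)) (gammaMap B h) := by
  obtain ⟨mRed, ⟨-, hbasic⟩, ⟨hanti, hsum⟩, hopt⟩ := hm
  have hsum' : ∑ j, anonymize h j = n := (sum_anonymize h id).trans hh
  have hgam : gammaMap B (anonymize h) = gammaMap B h := funext (gammaMap_anonymize B h)
  have h1 := hbasic _ (antitone_anonymize (reduce H h))
  simp only [cumPrev_anonymize] at h1
  have h2 := hopt _ (antitone_anonymize h) hsum'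
  have h3 := l1Dist_le_l1Upto_gammaMap hB hanti (antitone_anonymize h) hsum hsum'
  rw [hgam] at h2 h3
  have h4 := l1Upto_triangle n (gammaMap B m) (fun r => (cumPrev mRed r : ℝ)) (gammaMap B h)
  have h5 := l1Upto_triangle n (fun r => (cumPrev mRed r : ℝ))
    (fun r => (cumPrev (reduce H h) r : ℝ)) (gammaMap B h)
  have h6 := l1Upto_triangle n (fun r => (cumPrev mRed r : ℝ)) (phiHat p w)
    (fun r => (cumPrev (reduce H h) r : ℝ))
  have h7 : (1 : ℝ) / 2 ≤ 1 - 4 * n / (B : ℝ) := by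
    have hB' : (0 : ℝ) < B := by exact_mod_cast hB
    have : 4 * (n : ℝ) / B ≤ 1 / 2 := by
      rw [div_le_iff₀ hB']
      have : (8 : ℝ) * n ≤ B := by exact_mod_cast hnB
      linarith
    linarith
  have h8 := mul_le_mul_of_nonneg_right h7 (l1Dist_nonneg m (anonymize h))
  rw [l1Upto_comm n (fun r => (cumPrev (reduce H h) r : ℝ)) (phiHat p w)] at h1
  rw [l1Upto_comm n (gammaMap B h) fun r => (cumPrev mRed r : ℝ)] at h2
  linarith

theorem exists_abs_phiHat_sub_cumPrev_le {B : ℕ} {p : ℝ} (hp : 0 < p) :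
    ∃ K : ℝ, ∀ (w : Fin B → ℤ) (a : Fin B → ℕ) r, |phiHat p w r - cumPrev a r| ≤ K := by
  refine ⟨∑ _b : Fin B, (1 + p / (1 - p) ^ 2 + 1), fun w a r => ?_⟩
  rw [cumPrev_eq_sum, phiHat, ← Finset.sum_sub_distrib]
  refine (Finset.abs_sum_le_sum_abs _ _).trans (Finset.sum_le_sum fun b _ => ?_)
  refine (abs_sub _ _).trans (add_le_add (abs_postF_le hp _) ?_)
  unfold thr
  split_ifs <;> simp

theorem integral_l1Upto_phiHat_le {n B : ℕ} {p : ℝ} (hp : 0 < p) (hp1 : p < 1) {a : Fin B → ℕ}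
    (ha : ∑ b, a b = n) :
    ∫ w : Fin B → ℤ, l1Upto n (phiHat p fun b => (a b : ℤ) + w b) (fun r => (cumPrev a r : ℝ))
        ∂(Measure.pi fun _ : Fin B => dLap p) ≤
      Real.sqrt ((1 + Real.log n) * (6 * (n + B) / (1 - p) ^ 5)) := by
  have := isProbabilityMeasure_dLap hp hp1
  have hlog : 0 ≤ Real.log n := Real.log_natCast_nonneg n
  obtain ⟨K, hK⟩ := exists_abs_phiHat_sub_cumPrev_le (B := B) hp
  set μ := Measure.pi fun _ : Fin B => dLap p with hμ
  set d : (Fin B → ℤ) → ℕ → ℝ := fun w r =>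
    phiHat p (fun b => (a b : ℤ) + w b) r - cumPrev a r with hd
  have hdK : ∀ w r, |d w r| ≤ K := fun w r => hK _ a r
  set X : (Fin B → ℤ) → ℝ := fun w =>
    l1Upto n (phiHat p fun b => (a b : ℤ) + w b) fun r => (cumPrev a r : ℝ) with hX
  have hXb : ∀ w, ‖X w‖ ≤ ∑ _r ∈ Finset.Icc 1 n, K := fun w => by
    rw [Real.norm_of_nonneg (l1Upto_nonneg _ _ _)]
    exact Finset.sum_le_sum fun r _ => hdK w r
  have hXm : MemLp X 2 μ := MemLp.of_bound (Measurable.of_discrete).aestronglyMeasurable _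
    (Filter.Eventually.of_forall hXb)
  have hdint : ∀ r : ℕ, Integrable (fun w => (r : ℝ) * d w r ^ 2) μ := fun r =>
    (MemLp.integrable_sq (MemLp.of_bound (Measurable.of_discrete).aestronglyMeasurable K
      (Filter.Eventually.of_forall fun w => hdK w r))).const_mul _
  have hjensen : (∫ w, X w ∂μ) ^ 2 ≤ ∫ w, X w ^ 2 ∂μ := by
    have h1 := ProbabilityTheory.variance_eq_sub hXm
    have h2 := ProbabilityTheory.variance_nonneg X μ
    simp only [Pi.pow_apply] at h1
    linarith
  refine Real.le_sqrt_of_sq_le (hjensen.trans ?_)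
  calc ∫ w, X w ^ 2 ∂μ
      ≤ ∫ w, (1 + Real.log n) * ∑ r ∈ Finset.Icc 1 n, (r : ℝ) * d w r ^ 2 ∂μ :=
        integral_mono hXm.integrable_sq
          ((integrable_finsetSum _ fun r _ => hdint r).const_mul _) fun w => l1Upto_sq_le n _ _
    _ = (1 + Real.log n) * ∑ r ∈ Finset.Icc 1 n, (r : ℝ) * ∫ w, d w r ^ 2 ∂μ := by
        rw [integral_const_mul, integral_finsetSum _ fun r _ => hdint r]
        simp only [integral_const_mul]
    _ ≤ _ := mul_le_mul_of_nonneg_left (sum_mul_integral_phiHat_le hp hp1 ha) (by linarith)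

theorem expect_l1Upto_gammaMap_le {n D B : ℕ} (hB : 0 < B) {h : Fin D → ℕ}
    (hn : ∑ j, h j = n) :
    𝔼 H : Fin D → Fin B, l1Upto n (fun r => (cumPrev (reduce H h) r : ℝ)) (gammaMap B h) ≤
      Real.sqrt ((1 + Real.log n) * (3 * (n : ℝ) ^ 2 / B)) := by
  have : Nonempty (Fin B) := ⟨⟨0, hB⟩⟩
  have hlog : 0 ≤ Real.log n := Real.log_natCast_nonneg n
  refine Real.le_sqrt_of_sq_le ((sq_expect_le _).trans ?_)
  refine (Finset.expect_le_expect fun H _ => l1Upto_sq_le n _ _).trans ?_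
  rw [← Finset.mul_expect, Finset.expect_sum_comm]
  simp only [← Finset.mul_expect]
  exact mul_le_mul_of_nonneg_left (sum_mul_variance_cumPrev_reduce_le hB hn) (by linarith)

theorem l1Dist_estimate_le_two_mul {n D B : ℕ} {p : ℝ} {est : (Fin B → ℤ) → (Fin D → ℕ)}
    (hest : IsHashedEstimator p n est) (z : Fin n → Fin D) (w : Fin B → ℤ) :
    l1Dist (est w) (anonymize (hist z)) ≤ 2 * n := by
  obtain ⟨-, -, ⟨-, hsum⟩, -⟩ := hest w
  exact l1Dist_le hsum ((sum_anonymize _ id).trans (sum_hist z))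

theorem integral_mechanism {n D B : ℕ} (p : ℝ) (est : (Fin B → ℤ) → (Fin D → ℕ))
    (z : Fin n → Fin D) (g : (Fin D → ℕ) → ℝ) :
    ∫ m, g m ∂(mechanism p est z) = ∫ ω, g (est fun b => (reduce ω.1 (hist z) b : ℤ) + ω.2 b)
      ∂((hashLaw D B).prod (Measure.pi fun _ : Fin B => dLap p)) :=
  integral_map (Measurable.of_discrete).aemeasurable
    (Measurable.of_discrete).aestronglyMeasurable

theorem integrable_l1Dist_mechanism {n D B : ℕ} (hB : 0 < B) {p : ℝ} (hp : 0 < p) (hp1 : p < 1)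
    {est : (Fin B → ℤ) → (Fin D → ℕ)} (hest : IsHashedEstimator p n est) (z : Fin n → Fin D) :
    Integrable (fun m => l1Dist m (anonymize (hist z))) (mechanism p est z) := by
  have := isProbabilityMeasure_mechanism hB hp hp1 est z
  refine Integrable.of_bound (Measurable.of_discrete).aestronglyMeasurable (2 * n) ?_
  unfold mechanism
  rw [ae_map_iff (Measurable.of_discrete).aemeasurable MeasurableSet.of_discrete]
  refine Filter.Eventually.of_forall fun ω => ?_
  rw [Real.norm_of_nonneg (l1Dist_nonneg _ _)]
  exact l1Dist_estimate_le_two_mul hest z _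

theorem integral_l1Dist_mechanism_le_two_mul {n D B : ℕ} (hB : 0 < B) {p : ℝ} (hp : 0 < p)
    (hp1 : p < 1) {est : (Fin B → ℤ) → (Fin D → ℕ)} (hest : IsHashedEstimator p n est)
    (z : Fin n → Fin D) :
    ∫ m, l1Dist m (anonymize (hist z)) ∂(mechanism p est z) ≤ 2 * n := by
  have := isProbabilityMeasure_dLap hp hp1
  have : Nonempty (Fin B) := ⟨⟨0, hB⟩⟩
  have : IsProbabilityMeasure (hashLaw D B) :=
    ProbabilityTheory.isProbabilityMeasure_uniformOn Set.finite_univ Set.univ_nonempty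
  rw [integral_mechanism]
  refine (integral_mono_of_nonneg (Filter.Eventually.of_forall fun ω => l1Dist_nonneg _ _)
    (integrable_const (2 * (n : ℝ)))
    (Filter.Eventually.of_forall fun ω => l1Dist_estimate_le_two_mul hest z _)).trans_eq ?_
  simp

theorem integral_l1Dist_mechanism_le {n D B : ℕ} (hB : 0 < B) (hnB : 8 * n ≤ B) {p : ℝ}
    (hp : 0 < p) (hp1 : p < 1) {est : (Fin B → ℤ) → (Fin D → ℕ)}
    (hest : IsHashedEstimator p n est) (z : Fin n → Fin D) :
    ∫ m, l1Dist m (anonymize (hist z)) ∂(mechanism p est z) ≤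
      12 * Real.sqrt ((1 + Real.log n) * (6 * (n + B) / (1 - p) ^ 5)) := by
  have := isProbabilityMeasure_dLap hp hp1
  have : Nonempty (Fin B) := ⟨⟨0, hB⟩⟩
  have : IsProbabilityMeasure (hashLaw D B) :=
    ProbabilityTheory.isProbabilityMeasure_uniformOn Set.finite_univ Set.univ_nonempty
  have hB' : (0 : ℝ) < B := by exact_mod_cast hB
  have hlog : 0 ≤ Real.log n := Real.log_natCast_nonneg n
  set h := hist z with hh
  set μ := Measure.pi fun _ : Fin B => dLap p with hμ
  set T := Real.sqrt ((1 + Real.log n) * (6 * (n + B) / (1 - p) ^ 5)) with hT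
  set X : (Fin D → Fin B) → (Fin B → ℤ) → ℝ := fun H w =>
    l1Upto n (phiHat p fun b => (reduce H h b : ℤ) + w b)
      (fun r => (cumPrev (reduce H h) r : ℝ)) with hX
  set Y : (Fin D → Fin B) → ℝ := fun H =>
    l1Upto n (fun r => (cumPrev (reduce H h) r : ℝ)) (gammaMap B h) with hY
  obtain ⟨K, hK⟩ := exists_abs_phiHat_sub_cumPrev_le (B := B) hp
  have hXK : ∀ H w, ‖X H w‖ ≤ ∑ _r ∈ Finset.Icc 1 n, K := fun H w => by
    rw [Real.norm_of_nonneg (l1Upto_nonneg _ _ _)]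
    exact Finset.sum_le_sum fun r _ => hK _ _ r
  have hXint : ∀ H, Integrable (X H) μ := fun H =>
    Integrable.of_bound (Measurable.of_discrete).aestronglyMeasurable _
      (Filter.Eventually.of_forall (hXK H))
  have hYint : Integrable Y (hashLaw D B) := Integrable.of_finite
  have hint : Integrable (fun ω : (Fin D → Fin B) × (Fin B → ℤ) => 8 * X ω.1 ω.2 + 4 * Y ω.1)
      ((hashLaw D B).prod μ) := by
    refine Integrable.add (Integrable.const_mul ?_ _) ((hYint.comp_fst μ).const_mul _)
    exact Integrable.of_bound (Measurable.of_discrete).aestronglyMeasurable _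
      (Filter.Eventually.of_forall fun ω => hXK ω.1 ω.2)
  have hXT : ∀ H, ∫ w, X H w ∂μ ≤ T := fun H =>
    integral_l1Upto_phiHat_le hp hp1 ((sum_reduce H h).trans (sum_hist z))
  have hYT : 𝔼 H, Y H ≤ T := by
    refine (expect_l1Upto_gammaMap_le hB (sum_hist z)).trans (Real.sqrt_le_sqrt ?_)
    refine mul_le_mul_of_nonneg_left ?_ (by linarith)
    have h1 : 3 * (n : ℝ) ^ 2 / B ≤ 6 * (n + B) := by
      rw [div_le_iff₀ hB']
      have : 8 * (n : ℝ) ≤ B := by exact_mod_cast hnB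
      nlinarith [Nat.cast_nonneg (α := ℝ) n]
    refine h1.trans ?_
    rw [le_div_iff₀ (pow_pos (by linarith) 5)]
    exact mul_le_of_le_one_right (by positivity) (pow_le_one₀ (by linarith) (by linarith))
  rw [integral_mechanism]
  calc _ ≤ ∫ ω, (8 * X ω.1 ω.2 + 4 * Y ω.1) ∂((hashLaw D B).prod μ) :=
        integral_mono_of_nonneg (Filter.Eventually.of_forall fun ω => l1Dist_nonneg _ _) hint
          (Filter.Eventually.of_forall fun ω =>
            l1Dist_estimate_le hB hnB (sum_hist z) ω.1 (hest _))
    _ = 𝔼 H, (8 * ∫ w, X H w ∂μ + 4 * Y H) := by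
        rw [integral_prod _ hint, integral_hashLaw]
        refine Finset.expect_congr rfl fun H _ => ?_
        change ∫ w, (8 * X H w + 4 * Y H) ∂μ = _
        rw [integral_add ((hXint H).const_mul _) (integrable_const _), integral_const_mul]
        simp
    _ ≤ 8 * T + 4 * T := by
        rw [Finset.expect_add_distrib, ← Finset.mul_expect, ← Finset.mul_expect]
        have : 𝔼 H, ∫ w, X H w ∂μ ≤ T := Finset.expect_le Finset.univ_nonempty fun H _ => hXT H
        linarith
    _ = 12 * T := by ring

/-! ### The choice of the number of buckets -/

theorem div_add_le_one_sub_exp {ε ε₀ : ℝ} (hε : 0 < ε) (h : ε ≤ ε₀) :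
    ε / (2 + ε₀) ≤ 1 - Real.exp (-ε / 2) := by
  have h1 : Real.exp (-ε / 2) ≤ 2 / (2 + ε) := by
    rw [neg_div, Real.exp_neg, inv_le_comm₀ (Real.exp_pos _) (by positivity), inv_div]
    have := Real.add_one_le_exp (ε / 2)
    linarith
  have h2 : ε / (2 + ε₀) ≤ ε / (2 + ε) := by gcongr
  have h3 : ε / (2 + ε) = 1 - 2 / (2 + ε) := by field_simp; ring
  linarith

theorem rpow_sq {x : ℝ} (hx : 0 ≤ x) (y : ℝ) : (x ^ y) ^ 2 = x ^ (2 * y) := by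
  rw [← Real.rpow_natCast, ← Real.rpow_mul hx, mul_comm]
  norm_num

/-- The error bound for large `n`, with `q = 1 - p`, in terms of the claimed rate. -/
theorem sqrt_rate_le {n B ε ε₀ q : ℝ} (hn : 0 < n) (hL : 1 ≤ Real.log n)
    (hB : n + B ≤ 3 * (n * Real.sqrt (Real.log n))) (hε : 0 < ε) (hε₀ : 0 < ε₀)
    (hq : ε / (2 + ε₀) ≤ q) :
    Real.sqrt ((1 + Real.log n) * (6 * (n + B) / q ^ 5)) ≤
      6 * (2 + ε₀) ^ (5 / 2 : ℝ) *
        (Real.sqrt n * Real.log n ^ (3 / 4 : ℝ) / ε ^ (5 / 2 : ℝ)) := by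
  have hL0 : 0 ≤ Real.log n := by linarith
  have hq0 : 0 < ε / (2 + ε₀) := by positivity
  rw [Real.sqrt_le_left (by positivity)]
  have h1 : (6 * (2 + ε₀) ^ (5 / 2 : ℝ) *
      (Real.sqrt n * Real.log n ^ (3 / 4 : ℝ) / ε ^ (5 / 2 : ℝ))) ^ 2
      = 2 * Real.log n * (6 * (3 * (n * Real.sqrt (Real.log n))) / (ε / (2 + ε₀)) ^ 5) := by
    have e1 : ((2 + ε₀) ^ (5 / 2 : ℝ)) ^ 2 = (2 + ε₀) ^ 5 := by
      rw [rpow_sq (by linarith), ← Real.rpow_natCast]; norm_num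
    have e2 : (ε ^ (5 / 2 : ℝ)) ^ 2 = ε ^ 5 := by
      rw [rpow_sq hε.le, ← Real.rpow_natCast]; norm_num
    have e3 : (Real.log n ^ (3 / 4 : ℝ)) ^ 2 = Real.log n * Real.sqrt (Real.log n) := by
      rw [rpow_sq hL0, Real.sqrt_eq_rpow, ← Real.rpow_one_add' hL0 (by norm_num)]
      norm_num
    rw [mul_pow, mul_pow, div_pow, mul_pow, e1, e2, e3, Real.sq_sqrt hn.le]
    field_simp
    ring
  rw [h1]
  have h2 : 6 * (n + B) / q ^ 5 ≤ 6 * (3 * (n * Real.sqrt (Real.log n))) / (ε / (2 + ε₀)) ^ 5 := by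
    gcongr
  refine (mul_le_mul_of_nonneg_left h2 (by linarith)).trans
    (mul_le_mul_of_nonneg_right (by linarith) (by positivity))

/-- For bounded `n` the trivial error bound is within a constant factor of the claimed rate: here
`√n ≤ exp (81 / 2)`, and `log n` is bounded away from `0`. -/
theorem two_mul_le_rate {n ε ε₀ : ℝ} (hn : 2 ≤ n) (hL : Real.log n ≤ 81) (hε : 0 < ε)
    (hε₀ : ε ≤ ε₀) :
    2 * n ≤ 4 * Real.exp 41 * ε₀ ^ (5 / 2 : ℝ) *
        (Real.sqrt n * Real.log n ^ (3 / 4 : ℝ) / ε ^ (5 / 2 : ℝ)) := by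
  have hn0 : 0 < n := by linarith
  have hsq : Real.sqrt n ≤ Real.exp 41 := by
    rw [Real.sqrt_le_left (Real.exp_pos _).le, ← Real.exp_nat_mul, ← Real.log_le_iff_le_exp hn0]
    norm_num
    linarith
  have hlow : 1 / 2 ≤ Real.log n ^ (3 / 4 : ℝ) := by
    have h1 : (1 : ℝ) / 2 ≤ Real.log n :=
      (by linarith [Real.log_two_gt_d9] : (1 : ℝ) / 2 ≤ Real.log 2).trans
        (Real.log_le_log (by norm_num) hn)
    calc (1 : ℝ) / 2 = (1 / 2 : ℝ) ^ (1 : ℝ) := (Real.rpow_one _).symm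
      _ ≤ (1 / 2 : ℝ) ^ (3 / 4 : ℝ) :=
          Real.rpow_le_rpow_of_exponent_ge (by norm_num) (by norm_num) (by norm_num)
      _ ≤ _ := Real.rpow_le_rpow (by norm_num) h1 (by norm_num)
  have hratio : 1 ≤ ε₀ ^ (5 / 2 : ℝ) / ε ^ (5 / 2 : ℝ) := by
    rw [one_le_div (by positivity)]
    exact Real.rpow_le_rpow hε.le hε₀ (by norm_num)
  calc 2 * n = 4 * (Real.sqrt n * Real.sqrt n * (1 / 2) * 1) := by
        rw [Real.mul_self_sqrt hn0.le]; ring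
    _ ≤ 4 * (Real.exp 41 * Real.sqrt n * Real.log n ^ (3 / 4 : ℝ) *
          (ε₀ ^ (5 / 2 : ℝ) / ε ^ (5 / 2 : ℝ))) := by gcongr
    _ = _ := by ring

end AnonHist

theorem corollary4p2 (ε₀ : ℝ) (hε₀ : 0 < ε₀) :
    ∃ C : ℝ, 0 < C ∧
      ∀ (n D B : ℕ) (ε : ℝ), 2 ≤ n → |(B : ℝ) - n * Real.sqrt (Real.log n)| < 1 →
        0 < ε → ε ≤ ε₀ →
        ∀ est : (Fin B → ℤ) → (Fin D → ℕ),
          AnonHist.IsHashedEstimator (Real.exp (-ε / 2)) n est →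
          AnonHist.IsDP ε
              (fun z : Fin n → Fin D => AnonHist.mechanism (Real.exp (-ε / 2)) est z) ∧
            ∀ z : Fin n → Fin D,
              MeasureTheory.Integrable
                  (fun m => AnonHist.l1Dist m (AnonHist.anonymize (AnonHist.hist z)))
                  (AnonHist.mechanism (Real.exp (-ε / 2)) est z) ∧
                ∫ m, AnonHist.l1Dist m (AnonHist.anonymize (AnonHist.hist z))
                    ∂(AnonHist.mechanism (Real.exp (-ε / 2)) est z) ≤
                  C * (Real.sqrt n * Real.log n ^ (3 / 4 : ℝ) / ε ^ (5 / 2 : ℝ)) := by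
  refine ⟨72 * (2 + ε₀) ^ (5 / 2 : ℝ) + 4 * Real.exp 41 * ε₀ ^ (5 / 2 : ℝ), by positivity, ?_⟩
  intro n D B ε hn hBn hε hεε₀ est hest
  have hn' : (2 : ℝ) ≤ n := by exact_mod_cast hn
  obtain ⟨hB1, hB2⟩ := abs_lt.1 hBn
  have hlog2 : (1 : ℝ) / 2 ≤ Real.sqrt (Real.log n) := by
    refine Real.le_sqrt_of_sq_le ?_
    have := Real.log_le_log (by norm_num) hn'
    linarith [Real.log_two_gt_d9]
  have hB : 0 < B := by
    have : (0 : ℝ) < B := by nlinarith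
    exact_mod_cast this
  have hp : 0 < Real.exp (-ε / 2) := Real.exp_pos _
  have hp1 : Real.exp (-ε / 2) < 1 := by
    rw [← Real.exp_zero]
    exact Real.exp_lt_exp.2 (by linarith)
  refine ⟨AnonHist.isDP_mechanism hB hε est, fun z =>
    ⟨AnonHist.integrable_l1Dist_mechanism hB hp hp1 hest z, ?_⟩⟩
  have hlog0 : 0 ≤ Real.log n := Real.log_natCast_nonneg n
  set R := Real.sqrt n * Real.log n ^ (3 / 4 : ℝ) / ε ^ (5 / 2 : ℝ) with hR
  have hR0 : 0 ≤ R := by positivity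
  rw [add_mul]
  by_cases hnB : 8 * n ≤ B
  · have hnB' : 8 * (n : ℝ) ≤ B := by exact_mod_cast hnB
    -- If `√(log n) < 1`, then `B < n + 1`, too small for `8 * n ≤ B`.
    have hs : 1 ≤ Real.sqrt (Real.log n) := by
      by_contra hlt
      push Not at hlt
      nlinarith
    have hL : 1 ≤ Real.log n := by
      rwa [Real.one_le_sqrt] at hs
    have h1 := AnonHist.integral_l1Dist_mechanism_le hB hnB hp hp1 hest z
    have h2 := AnonHist.sqrt_rate_le (n := n) (B := B) (by linarith) hL (by nlinarith) hε hε₀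
      (AnonHist.div_add_le_one_sub_exp hε hεε₀)
    have h3 : 0 ≤ 4 * Real.exp 41 * ε₀ ^ (5 / 2 : ℝ) * R := by positivity
    rw [← hR] at h2
    linarith
  · -- Here `n` is bounded by an absolute constant, and the trivial bound `2 * n` suffices.
    have hnB' : (B : ℝ) ≤ 8 * n := by
      push Not at hnB
      exact_mod_cast hnB.le
    have hs : Real.sqrt (Real.log n) ≤ 9 := by
      by_contra hlt
      push Not at hlt
      nlinarith
    have hL : Real.log n ≤ 81 := by
      have := (Real.sqrt_le_left (by norm_num)).1 hs
      linarith
    have h1 := AnonHist.integral_l1Dist_mechanism_le_two_mul hB hp hp1 hest z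
    have h2 := AnonHist.two_mul_le_rate hn' hL hε hεε₀
    have h3 : 0 ≤ 72 * (2 + ε₀) ^ (5 / 2 : ℝ) * R := by positivity
    linarith
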